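/- Let $d\ge 1$ and let $\mathbb N$ be the set of positive integers. For a function $f:\mathbb N^d\to\mathbb C$ with finite support, of cardinality $K$, and for $\alpha\in(0,1]$, put \[ S_f(d;\alpha)=\sum_{\boldsymbol a,\boldsymbol b\in\mathbb N^d} f(\boldsymbol a)\overline{f(\boldsymbol b)}\prod_{i=1}^d\frac{\gcd(a_i,b_i)^{2\alpha}}{(a_ib_i)^{\alpha}}, \qquad \|f\|_1=\sum_{\boldsymbol a}|f(\boldsymbol a)|,\qquad \|f\|_2=\Bigl(\sum_{\boldsymbol a}|f(\boldsymbol a)|^2\Bigr)^{1/2}. \] (i) There are constants $A,M>0$, depending only on $d$, such that for all such $f$ with $K\ge 3$, \[ |S_f(d;1)|\le M(\log\log K)^{A}\,\|f\|_2^2 . \] (ii) For every $\alpha$ with $1/2<\alpha<1$ there are constants $C,M>0$, depending only on $\alpha$ and $d$, such that for all such $f$ with $K\ge 3$, \[ |S_f(d;\alpha)|\le M\exp\bigl(C(\log K)^{1-\alpha}(\log\log K)^{-\alpha}\bigr)\|f\|_2^2 . \] (iii) There are constants $C,M>0$, depending only on $d$, such that for all such $f$ that are real-valued and positive on their support (that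 is, $f\ge 0$) with $\|f\|_1\ge 3$ and $K\ge\log\|f\|_1$, \[ |S_f(d;1/2)|\le M\,\frac{\exp\bigl(C(\log K\,\log\log\|f\|_1)^{1/2}\bigr)}{(\log\|f\|_1)^{d}}\,\|f\|_2^2 . \] -/

import Mathlib

/-- The `d`-dimensional GCD sum
`S_f(d; α) = ∑_{a, b ∈ ℕ^d} f(a) conj(f(b)) ∏_i (a_i, b_i)^{2α} / (a_i b_i)^α`
of a finitely supported function `f` on `d`-tuples of positive integers. All terms with `a` or `b`
outside the support of `f` vanish, so the sum is taken over the support. -/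
noncomputable def gcdSum (d : ℕ) (α : ℝ) (f : (Fin d → ℕ+) →₀ ℂ) : ℂ :=
  ∑ a ∈ f.support, ∑ b ∈ f.support,
    f a * (starRingEnd ℂ) (f b) *
      ((∏ i : Fin d, ((Nat.gcd (a i : ℕ) (b i : ℕ) : ℝ) ^ (2 * α) /
        (((a i : ℕ) : ℝ) * ((b i : ℕ) : ℝ)) ^ α) : ℝ) : ℂ)

/-- The `ℓ¹` norm `‖f‖₁ = ∑_a |f(a)|`. -/
noncomputable def l1Norm {d : ℕ} (f : (Fin d → ℕ+) →₀ ℂ) : ℝ :=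
  ∑ a ∈ f.support, ‖f a‖

/-- The `ℓ²` norm `‖f‖₂ = (∑_a |f(a)|²)^{1/2}`. -/
noncomputable def l2Norm {d : ℕ} (f : (Fin d → ℕ+) →₀ ℂ) : ℝ :=
  Real.sqrt (∑ a ∈ f.support, ‖f a‖ ^ 2)

/-! Writing each coordinate by its prime valuations turns the GCD kernel into a tensor product, over
coordinates and primes, of the kernels `ρ ^ |v - w|` with `ρ = p ^ (-α)`. On `ℓ²` such a factor has
norm about `1 + 2ρ`, and the product over all primes diverges. The remedy is to measure the kernels
on `ℓ^q × ℓ^q` with `q = 2 / (1 + ε)`. These bounds still multiply under tensor products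
(`HasPowerBound.prod`), and returning to `ℓ²` on a support of `K` points costs only `K ^ ε` by the
power mean inequality (`norm_gcdSum_le`).

The gain is local. In a unit vector every entry but the largest has square `s ^ 2 ≤ 1/2`, and there
`s ^ 2 - s ^ (2 + 2ε)` is at least `ε s ^ 2 / 2`. Completing the square against this gap replaces `1
+ O(ρ)` by `1 + O(ρ² / ε)` once `ρ ≤ ε / 16`, and by `1 + O(ρ² / (ε log (1/ρ)))` once `ρ ≤ ε² / 64`.

Chebyshev's bound on dyadic blocks then leaves an optimisation in `ε`. It is about `1 / log K` for
`α = 1`, `(log K loglog K) ^ (-α)` for `1/2 < α < 1`, and `(log K) ^ (-1/2)` for `α = 1/2`. In the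
last case the logarithmic saving is what makes the sum over primes converge, and the result is `exp
(C √(log K))`. Part (iii) follows because `K ≥ log ‖f‖₁` lets the denominator be absorbed into the
exponential. -/

open Finset

/-! ### The local kernel: row sums and positivity. -/

/-- The kernel `ρ ^ |v - w|` on natural numbers. -/
def expKernel (ρ : ℝ) (v w : ℕ) : ℝ := ρ ^ ((v - w) + (w - v))

lemma expKernel_nonneg {ρ : ℝ} (hρ : 0 ≤ ρ) (v w : ℕ) : 0 ≤ expKernel ρ v w :=
  pow_nonneg hρ _

lemma expKernel_comm (ρ : ℝ) (v w : ℕ) : expKernel ρ v w = expKernel ρ w v := by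
  unfold expKernel; rw [add_comm]

lemma expKernel_self (ρ : ℝ) (v : ℕ) : expKernel ρ v v = 1 := by
  simp [expKernel]

lemma sum_range_pow_sub_le {x : ℝ} (hx0 : 0 ≤ x) (hx1 : x < 1) (v : ℕ) :
    ∑ w ∈ range v, x ^ (v - w) ≤ x / (1 - x) := by
  have h1 : 0 < 1 - x := by linarith
  induction v with
  | zero => simp; positivity
  | succ v ih =>
    rw [sum_range_succ]
    have h : ∑ w ∈ range v, x ^ (v + 1 - w) = x * ∑ w ∈ range v, x ^ (v - w) := by
      rw [mul_sum]
      refine sum_congr rfl fun w hw => ?_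
      have := mem_range.1 hw
      rw [← pow_succ']; congr 1; omega
    rw [h]
    have h2 : x / (1 - x) = x * (x / (1 - x)) + x := by field_simp; ring
    have h3 : v + 1 - v = 1 := by omega
    rw [h3, pow_one, h2]
    gcongr

lemma sum_Ico_pow_sub_le {x : ℝ} (hx0 : 0 ≤ x) (hx1 : x < 1) (v m : ℕ) :
    ∑ w ∈ Ico (v + 1) m, x ^ (w - v) ≤ x / (1 - x) := by
  rw [sum_Ico_eq_sum_range]
  have h1 : 0 < 1 - x := by linarith
  have h : ∀ n : ℕ, ∑ k ∈ range n, x ^ (v + 1 + k - v) ≤ x / (1 - x) := by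
    intro n
    have h2 := sum_range_pow_sub_le hx0 hx1 n
    rw [← sum_range_reflect] at h2
    refine le_trans (le_of_eq (sum_congr rfl fun w hw => ?_)) h2
    have := mem_range.1 hw
    congr 1; omega
  exact h _

/-- The off-diagonal row sums of the kernel `x ^ |v - w|` are at most `2x / (1 - x)`. -/
lemma sum_erase_expKernel_le {x : ℝ} (hx0 : 0 ≤ x) (hx1 : x < 1) {m : ℕ} (v : Fin m) :
    ∑ w ∈ univ.erase v, expKernel x v w ≤ 2 * (x / (1 - x)) := by
  have h1 : ∑ w ∈ univ.erase v, expKernel x v w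
      = ∑ w ∈ (range m).erase v, expKernel x v w := by
    have h := Fin.sum_univ_eq_sum_range (fun w => expKernel x v w) m
    rw [← add_sum_erase _ _ (mem_univ v), ← add_sum_erase _ _ (mem_range.2 v.2)] at h
    linarith
  have h2 : (range m).erase (v : ℕ) = range v ∪ Ico (v + 1) m := by
    ext w; simp only [mem_erase, mem_range, mem_union, mem_Ico]; omega
  rw [h1, h2, sum_union]
  · have ha := sum_range_pow_sub_le hx0 hx1 v
    have hb := sum_Ico_pow_sub_le hx0 hx1 v m
    have ha' : ∑ w ∈ range v, expKernel x v w = ∑ w ∈ range v, x ^ ((v : ℕ) - w) := by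
      refine sum_congr rfl fun w hw => ?_
      have := mem_range.1 hw
      unfold expKernel; congr 1; omega
    have hb' : ∑ w ∈ Ico ((v : ℕ) + 1) m, expKernel x v w
        = ∑ w ∈ Ico ((v : ℕ) + 1) m, x ^ (w - (v : ℕ)) := by
      refine sum_congr rfl fun w hw => ?_
      have := mem_Ico.1 hw
      unfold expKernel; congr 1; omega
    rw [ha', hb']; linarith
  · rw [disjoint_left]; intro w hw hw'
    have := mem_range.1 hw; have := mem_Ico.1 hw'; omega

/-- Schur's test for a symmetric nonnegative kernel. -/
lemma schur_test {Y : Type*} {s : Finset Y} {k : Y → Y → ℝ} {R : ℝ}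
    (hk : ∀ v w, 0 ≤ k v w) (hs : ∀ v w, k v w = k w v)
    (hR : ∀ v ∈ s, ∑ w ∈ s, k v w ≤ R) (f : Y → ℝ) :
    ∑ v ∈ s, ∑ w ∈ s, f v * f w * k v w ≤ ∑ v ∈ s, f v ^ 2 * R := by
  have h1 : ∑ v ∈ s, ∑ w ∈ s, f v * f w * k v w
      ≤ ∑ v ∈ s, ∑ w ∈ s, (f v ^ 2 * k v w / 2 + f w ^ 2 * k w v / 2) := by
    refine sum_le_sum fun v _ => sum_le_sum fun w _ => ?_
    rw [hs w v]
    nlinarith [mul_nonneg (hk v w) (sq_nonneg (f v - f w))]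
  have h2 : ∑ v ∈ s, ∑ w ∈ s, f w ^ 2 * k w v / 2 = ∑ v ∈ s, ∑ w ∈ s, f v ^ 2 * k v w / 2 :=
    sum_comm
  simp only [sum_add_distrib] at h1
  rw [h2, ← two_mul, mul_sum] at h1
  refine h1.trans (sum_le_sum fun v hv => ?_)
  rw [← sum_div, ← mul_sum]
  have := mul_le_mul_of_nonneg_left (hR v hv) (sq_nonneg (f v))
  linarith

lemma sum_expKernel_le {x : ℝ} (hx0 : 0 ≤ x) (hx1 : x < 1) {m : ℕ} (s : Finset (Fin m))
    (v : Fin m) : ∑ w ∈ s, expKernel x v w ≤ 1 + 2 * (x / (1 - x)) := by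
  have h := sum_erase_expKernel_le hx0 hx1 v
  have h2 : ∑ w ∈ s, expKernel x v w ≤ ∑ w : Fin m, expKernel x v w :=
    sum_le_sum_of_subset_of_nonneg (subset_univ _) fun w _ _ => expKernel_nonneg hx0 _ _
  rw [← add_sum_erase _ _ (mem_univ v), expKernel_self] at h2
  linarith

/-- The kernel `ρ ^ |v - w|` is positive semidefinite. -/
lemma expKernel_posSemidef {ρ : ℝ} (hρ0 : 0 < ρ) (hρ1 : ρ ≤ 1) {m : ℕ} (h : Fin m → ℝ) :
    0 ≤ ∑ v, ∑ w, h v * h w * expKernel ρ v w := by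
  -- Since `ρ ^ |v - w| = ρ ^ (v + w) * ρ ^ (-2 min v w)`, the increments of `ρ ^ (-2j)` express the
  -- kernel as a nonnegative combination of rank-one squares.
  set c : ℕ → ℝ := fun j => if j = 0 then 1 else (ρ⁻¹ ^ 2) ^ j - (ρ⁻¹ ^ 2) ^ (j - 1) with hc
  have hinv : 1 ≤ ρ⁻¹ ^ 2 := one_le_pow₀ ((one_le_inv₀ hρ0).2 hρ1)
  have hc0 : ∀ j, 0 ≤ c j := by
    intro j
    simp only [hc]
    split_ifs
    · exact zero_le_one
    · exact sub_nonneg.2 (pow_le_pow_right₀ hinv (by omega))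
  have hcs : ∀ n, ∑ j ∈ range (n + 1), c j = (ρ⁻¹ ^ 2) ^ n := by
    intro n
    induction n with
    | zero => simp [hc]
    | succ n ih => rw [sum_range_succ, ih]; simp [hc]
  have hk : ∀ v w : Fin m, expKernel ρ v w
      = ∑ j ∈ range m, c j * ((if j ≤ v then ρ ^ (v : ℕ) else 0) *
          (if j ≤ w then ρ ^ (w : ℕ) else 0)) := by
    intro v w
    have h1 : ∀ j ∈ range m, c j * ((if j ≤ v then ρ ^ (v : ℕ) else 0) *
          (if j ≤ w then ρ ^ (w : ℕ) else 0))
        = if j ∈ range (min (v : ℕ) w + 1) then c j * (ρ ^ (v : ℕ) * ρ ^ (w : ℕ)) else 0 := by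
      intro j _
      simp only [mem_range, Nat.lt_succ_iff, le_min_iff]
      by_cases h1 : j ≤ v <;> by_cases h2 : j ≤ w <;> simp [h1, h2]
    rw [sum_congr rfl h1, ← sum_filter]
    have h2 : (range m).filter (fun j => j ∈ range (min (v : ℕ) w + 1))
        = range (min (v : ℕ) w + 1) := by
      ext j; simp only [mem_filter, mem_range]; have := v.2; omega
    rw [h2, ← sum_mul, hcs]
    unfold expKernel
    rw [← pow_mul, ← pow_add, inv_pow, eq_comm, inv_mul_eq_div, div_eq_iff (by positivity),
      ← pow_add]
    congr 1; omega
  have h2 : ∑ v, ∑ w, h v * h w * expKernel ρ v w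
      = ∑ j ∈ range m, c j * (∑ v : Fin m, h v * (if j ≤ v then ρ ^ (v : ℕ) else 0)) ^ 2 := by
    simp only [hk, mul_sum]
    rw [sum_congr rfl fun v _ => sum_comm, sum_comm]
    refine sum_congr rfl fun j _ => ?_
    rw [sq, sum_mul_sum, mul_sum]
    refine sum_congr rfl fun v _ => ?_
    rw [mul_sum]
    exact sum_congr rfl fun w _ => by ring
  rw [h2]
  exact sum_nonneg fun j _ => mul_nonneg (hc0 j) (sq_nonneg _)

/-! ### Power bounds and their multiplicativity. -/

/-- `k` is bounded by `N` as a bilinear form on `ℓ^q × ℓ^q` with `q = 2 / (1 + ε)`; functions in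
`ℓ^q` are written as `(1 + ε)`-th powers of functions in `ℓ²`. -/
def HasPowerBound {Y : Type*} [Fintype Y] (ε : ℝ) (k : Y → Y → ℝ) (N : ℝ) : Prop :=
  ∀ F G : Y → ℝ, (∀ x, 0 ≤ F x) → (∀ x, 0 ≤ G x) →
    ∑ x, ∑ y, F x ^ (1 + ε) * G y ^ (1 + ε) * k x y
      ≤ N * (√(∑ x, F x ^ 2) * √(∑ x, G x ^ 2)) ^ (1 + ε)

/-- For a positive semidefinite kernel it suffices to bound the quadratic form on unit vectors. -/
lemma HasPowerBound.of_quadratic {Y : Type*} [Fintype Y] {ε N : ℝ} {k : Y → Y → ℝ} (hε : 0 ≤ ε)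
    (hs : ∀ v w, k v w = k w v)
    (hpos : ∀ h : Y → ℝ, 0 ≤ ∑ v, ∑ w, h v * h w * k v w)
    (hq : ∀ F : Y → ℝ, (∀ x, 0 ≤ F x) → ∑ x, F x ^ 2 = 1 →
      ∑ x, ∑ y, F x ^ (1 + ε) * F y ^ (1 + ε) * k x y ≤ N) : HasPowerBound ε k N := by
  intro F G hF hG
  have hε1 : 1 + ε ≠ 0 := by linarith
  by_cases hF0 : ∑ x, F x ^ 2 = 0
  · have h0 : ∀ x, F x = 0 := fun x => by
      have := (sum_eq_zero_iff_of_nonneg fun x _ => sq_nonneg (F x)).1 hF0 x (mem_univ x)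
      exact pow_eq_zero_iff (two_ne_zero) |>.1 this
    simp [h0, Real.zero_rpow hε1]
  by_cases hG0 : ∑ x, G x ^ 2 = 0
  · have h0 : ∀ x, G x = 0 := fun x => by
      have := (sum_eq_zero_iff_of_nonneg fun x _ => sq_nonneg (G x)).1 hG0 x (mem_univ x)
      exact pow_eq_zero_iff (two_ne_zero) |>.1 this
    simp [h0, Real.zero_rpow hε1]
  have unit : ∀ H : Y → ℝ, (∀ x, 0 ≤ H x) → ∑ x, H x ^ 2 ≠ 0 → 0 < √(∑ x, H x ^ 2) ∧
      ∑ x, (H x / √(∑ x, H x ^ 2)) ^ 2 = 1 := by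
    intro H hH h0
    have hp : 0 < ∑ x, H x ^ 2 := lt_of_le_of_ne (sum_nonneg fun x _ => sq_nonneg _) h0.symm
    refine ⟨Real.sqrt_pos.2 hp, ?_⟩
    simp only [div_pow, Real.sq_sqrt hp.le]
    rw [← sum_div, div_self h0]
  obtain ⟨ha, hF1⟩ := unit F hF hF0
  obtain ⟨hb, hG1⟩ := unit G hG hG0
  set a := √(∑ x, F x ^ 2)
  set b := √(∑ x, G x ^ 2)
  have q1 := hq (fun x => F x / a) (fun x => div_nonneg (hF x) ha.le) hF1
  have q2 := hq (fun x => G x / b) (fun x => div_nonneg (hG x) hb.le) hG1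
  set f : Y → ℝ := fun x => (F x / a) ^ (1 + ε) with hf
  set g : Y → ℝ := fun x => (G x / b) ^ (1 + ε) with hg
  have key : ∑ x, ∑ y, f x * g y * k x y ≤ N := by
    -- Positivity at `f - g` bounds twice the mixed form by the sum of the two diagonal forms.
    have h := hpos (fun x => f x - g x)
    have h1 : ∑ v, ∑ w, (f v - g v) * (f w - g w) * k v w
        = ∑ v, ∑ w, f v * f w * k v w + ∑ v, ∑ w, g v * g w * k v w
          - ∑ v, ∑ w, f v * g w * k v w - ∑ v, ∑ w, f w * g v * k w v := by
      simp only [← sum_add_distrib, ← sum_sub_distrib]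
      refine sum_congr rfl fun v _ => sum_congr rfl fun w _ => ?_
      rw [hs w v]; ring
    have h2 : ∑ v, ∑ w, f w * g v * k w v = ∑ v, ∑ w, f v * g w * k v w := sum_comm
    rw [h1, h2] at h
    linarith
  have h3 : ∑ x, ∑ y, F x ^ (1 + ε) * G y ^ (1 + ε) * k x y
      = (∑ x, ∑ y, f x * g y * k x y) * (a * b) ^ (1 + ε) := by
    rw [sum_mul]
    refine sum_congr rfl fun x _ => ?_
    rw [sum_mul]
    refine sum_congr rfl fun y _ => ?_
    simp only [hf, hg]
    rw [Real.div_rpow (hF x) ha.le, Real.div_rpow (hG y) hb.le, Real.mul_rpow ha.le hb.le]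
    have := (Real.rpow_pos_of_pos ha (1 + ε)).ne'
    have := (Real.rpow_pos_of_pos hb (1 + ε)).ne'
    field_simp
  rw [h3]
  exact mul_le_mul_of_nonneg_right key (Real.rpow_nonneg (mul_pos ha hb).le _)

/-- Bounds pass to restrictions along an injective map. -/
lemma HasPowerBound.comp_injective {X Y : Type*} [Fintype X] [Fintype Y] {ε N : ℝ}
    {k : Y → Y → ℝ} (hε : 0 ≤ ε) (h : HasPowerBound ε k N) {φ : X → Y}
    (hφ : Function.Injective φ) : HasPowerBound ε (fun x y => k (φ x) (φ y)) N := by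
  intro F G hF hG
  have hε1 : 1 + ε ≠ 0 := by linarith
  have ext0 : ∀ H : X → ℝ, ∀ y, y ∉ Set.range φ → Function.extend φ H 0 y = 0 := by
    intro H y hy
    rw [Function.extend_apply' _ _ _ (by simpa using hy)]; rfl
  have extn : ∀ H : X → ℝ, (∀ x, 0 ≤ H x) → ∀ y, 0 ≤ Function.extend φ H 0 y := by
    intro H hH y
    by_cases hy : y ∈ Set.range φ
    · obtain ⟨x, rfl⟩ := hy
      rw [hφ.extend_apply]; exact hH x
    · rw [ext0 H y hy]
  have extsq : ∀ H : X → ℝ, ∑ y, Function.extend φ H 0 y ^ 2 = ∑ x, H x ^ 2 := by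
    intro H
    refine (Fintype.sum_of_injective φ hφ _ _ (fun y hy => ?_) fun x => ?_).symm
    · rw [ext0 H y hy]; simp
    · rw [hφ.extend_apply]
  have h1 := h (Function.extend φ F 0) (Function.extend φ G 0) (extn F hF) (extn G hG)
  rw [extsq, extsq] at h1
  refine le_trans (le_of_eq ?_) h1
  refine Fintype.sum_of_injective φ hφ _ _ (fun y hy => ?_) fun x => ?_
  · simp [ext0 F y hy, Real.zero_rpow hε1]
  · refine Fintype.sum_of_injective φ hφ _ _ (fun y hy => ?_) fun x' => ?_
    · simp [ext0 G y hy, Real.zero_rpow hε1]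
    · simp only [hφ.extend_apply]

/-- Bounds of nonnegative kernels multiply under tensor products. -/
lemma HasPowerBound.prod {X Y : Type*} [Fintype X] [Fintype Y] {ε M N : ℝ}
    {k : X → X → ℝ} {l : Y → Y → ℝ} (hk0 : ∀ x x', 0 ≤ k x x') (hN : 0 ≤ N)
    (hk : HasPowerBound ε k M) (hl : HasPowerBound ε l N) :
    HasPowerBound ε (fun a b : X × Y => k a.1 b.1 * l a.2 b.2) (M * N) := by
  intro F G hF hG
  have nn : ∀ (H : X × Y → ℝ) x, 0 ≤ ∑ y, H (x, y) ^ 2 := fun H x =>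
    sum_nonneg fun y _ => sq_nonneg _
  -- The bound for `l` on a pair of fibres yields fibre norms raised to the power `1 + ε`, exactly
  -- the input that the bound for `k` accepts, so nothing is lost.
  have h1 := hk (fun x => √(∑ y, F (x, y) ^ 2)) (fun x => √(∑ y, G (x, y) ^ 2))
    (fun _ => Real.sqrt_nonneg _) (fun _ => Real.sqrt_nonneg _)
  simp only [Real.sq_sqrt (nn _ _)] at h1
  rw [← Fintype.sum_prod_type (f := fun a => F a ^ 2),
    ← Fintype.sum_prod_type (f := fun a => G a ^ 2)] at h1
  have h2 : ∑ a : X × Y, ∑ b : X × Y,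
        F a ^ (1 + ε) * G b ^ (1 + ε) * (k a.1 b.1 * l a.2 b.2)
      = ∑ x, ∑ x', k x x' * ∑ y, ∑ y',
          F (x, y) ^ (1 + ε) * G (x', y') ^ (1 + ε) * l y y' := by
    simp only [Fintype.sum_prod_type, mul_sum]
    refine sum_congr rfl fun x _ => ?_
    rw [sum_comm]
    refine sum_congr rfl fun x' _ => sum_congr rfl fun y _ => sum_congr rfl fun y' _ => ?_
    ring
  rw [h2, mul_comm M N, mul_assoc]
  refine le_trans ?_ (mul_le_mul_of_nonneg_left h1 hN)
  rw [mul_sum]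
  refine sum_le_sum fun x _ => ?_
  rw [mul_sum]
  refine sum_le_sum fun x' _ => ?_
  have h3 := mul_le_mul_of_nonneg_left (hl (fun y => F (x, y)) (fun y => G (x', y))
    (fun y => hF _) (fun y => hG _)) (hk0 x x')
  refine h3.trans (le_of_eq ?_)
  rw [Real.mul_rpow (Real.sqrt_nonneg _) (Real.sqrt_nonneg _)]
  ring

lemma HasPowerBound.pi_fin {Y : Type*} [Fintype Y] {ε : ℝ} (hε : 0 ≤ ε) :
    ∀ (n : ℕ) (k : Fin n → Y → Y → ℝ) (N : Fin n → ℝ), (∀ i x y, 0 ≤ k i x y) →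
      (∀ i, 0 ≤ N i) → (∀ i, HasPowerBound ε (k i) (N i)) →
      HasPowerBound ε (fun a b : Fin n → Y => ∏ i, k i (a i) (b i)) (∏ i, N i)
  | 0, k, N, _, _, _ => by
    intro F G hF hG
    simp [Real.sqrt_sq (hF _), Real.sqrt_sq (hG _), Real.mul_rpow (hF _) (hG _)]
  | n + 1, k, N, hk, hN, h => by
    have ih := HasPowerBound.pi_fin hε n (fun i => k i.succ) (fun i => N i.succ)
      (fun i => hk i.succ) (fun i => hN i.succ) (fun i => h i.succ)
    have h1 := HasPowerBound.prod (hk 0) (prod_nonneg fun i _ => hN i.succ) (h 0) ih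
    have h2 := h1.comp_injective hε (Fin.consEquiv fun _ => Y).symm.injective
    simp only [Fin.prod_univ_succ]
    exact h2

lemma HasPowerBound.pi {ι Y : Type*} [Fintype ι] [DecidableEq ι] [Fintype Y] {ε : ℝ} (hε : 0 ≤ ε)
    (k : ι → Y → Y → ℝ) (N : ι → ℝ) (hk : ∀ i x y, 0 ≤ k i x y) (hN : ∀ i, 0 ≤ N i)
    (h : ∀ i, HasPowerBound ε (k i) (N i)) :
    HasPowerBound ε (fun a b : ι → Y => ∏ i, k i (a i) (b i)) (∏ i, N i) := by
  let e := (Fintype.equivFin ι).symm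
  have h1 := HasPowerBound.pi_fin hε _ (fun i => k (e i)) (fun i => N (e i))
    (fun i => hk _) (fun i => hN _) (fun i => h _)
  have h2 := h1.comp_injective hε (φ := fun a : ι → Y => fun i => a (e i))
    (fun a b hab => funext fun i => by simpa using congrFun hab (e.symm i))
  rw [e.prod_comp N] at h2
  convert h2 using 3 with a b
  exact (e.prod_comp fun i => k i (a i) (b i)).symm

lemma HasPowerBound.mono {Y : Type*} [Fintype Y] {ε M N : ℝ} {k : Y → Y → ℝ} (hMN : M ≤ N)
    (h : HasPowerBound ε k M) : HasPowerBound ε k N := fun F G hF hG =>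
  (h F G hF hG).trans (mul_le_mul_of_nonneg_right hMN (by positivity))

/-! ### Local bounds at a single prime. -/

lemma expKernel_hasPowerBound_of_quadratic {ρ ε N : ℝ} (hρ0 : 0 < ρ) (hρ1 : ρ ≤ 1) (hε : 0 ≤ ε)
    {m : ℕ} (hq : ∀ F : Fin m → ℝ, (∀ x, 0 ≤ F x) → ∑ x, F x ^ 2 = 1 →
      ∑ x, ∑ y, F x ^ (1 + ε) * F y ^ (1 + ε) * expKernel ρ x y ≤ N) :
    HasPowerBound ε (fun v w : Fin m => expKernel ρ v w) N :=
  .of_quadratic hε (fun _ _ => expKernel_comm _ _ _) (fun h => expKernel_posSemidef hρ0 hρ1 h) hq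

lemma le_one_of_sum_sq_eq_one {Y : Type*} [Fintype Y] {F : Y → ℝ}
    (h1 : ∑ x, F x ^ 2 = 1) (x : Y) : F x ≤ 1 := by
  have := single_le_sum (f := fun x => F x ^ 2) (fun y _ => sq_nonneg (F y)) (mem_univ x)
  simp only [h1] at this
  nlinarith

lemma rpow_one_add_le {s ε : ℝ} (hε : 0 ≤ ε) (hs0 : 0 ≤ s) (hs1 : s ≤ 1) : s ^ (1 + ε) ≤ s := by
  simpa using Real.rpow_le_rpow_of_exponent_ge' hs0 hs1 zero_le_one (by linarith : 1 ≤ 1 + ε)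

/-- The bound for the kernel `ρ ^ |v - w|` from its row sums. -/
lemma expKernel_hasPowerBound_trivial {ρ ε : ℝ} (hρ0 : 0 < ρ) (hρ1 : ρ < 1) (hε : 0 ≤ ε) (m : ℕ) :
    HasPowerBound ε (fun v w : Fin m => expKernel ρ v w) (1 + 2 * (ρ / (1 - ρ))) := by
  refine expKernel_hasPowerBound_of_quadratic hρ0 hρ1.le hε fun F hF h1 => ?_
  refine (schur_test (s := univ) (fun v w => expKernel_nonneg hρ0.le _ _)
    (fun v w => expKernel_comm _ _ _) (fun v _ => sum_expKernel_le hρ0.le hρ1 univ v)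
    (fun x => F x ^ (1 + ε))).trans ?_
  rw [← sum_mul]
  refine mul_le_of_le_one_left ?_ ?_
  · have : 0 < 1 - ρ := by linarith
    positivity
  · refine le_trans (sum_le_sum fun x _ => ?_) h1.le
    exact pow_le_pow_left₀ (Real.rpow_nonneg (hF x) _)
      (rpow_one_add_le hε (hF x) (le_one_of_sum_sq_eq_one h1 x)) 2

/-- The bound for the kernel `ρ ^ |v - w|` obtained by splitting off the largest value. -/
lemma expKernel_hasPowerBound_of_pointwise {ρ ε E : ℝ} (hρ0 : 0 < ρ) (hρ1 : ρ < 1) (hε : 0 ≤ ε)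
    (hE0 : 0 ≤ E)
    (hE : ∀ s : ℝ, 0 ≤ s → s ^ 2 ≤ 1 / 2 → ∀ k : ℕ, 1 ≤ k →
      2 * s ^ (1 + ε) * ρ ^ k + (s ^ (1 + ε)) ^ 2 * (1 + 2 * (ρ / (1 - ρ))) - s ^ 2
        ≤ E * (ρ ^ 2) ^ k) (m : ℕ) :
    HasPowerBound ε (fun v w : Fin m => expKernel ρ v w)
      (1 + E * (2 * (ρ ^ 2 / (1 - ρ ^ 2)))) := by
  refine expKernel_hasPowerBound_of_quadratic hρ0 hρ1.le hε fun F hF h1 => ?_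
  have hm : Nonempty (Fin m) := by
    by_contra h
    rw [not_nonempty_iff] at h
    simp at h1
  -- Any other entry is at most `F v` and shares a total square mass of 1 with it, so its square is
  -- at most `1/2`.
  obtain ⟨v, -, hv⟩ := exists_max_image univ F univ_nonempty
  set f : Fin m → ℝ := fun x => F x ^ (1 + ε) with hf
  have hf0 : ∀ x, 0 ≤ f x := fun x => Real.rpow_nonneg (hF x) _
  have hF1 := le_one_of_sum_sq_eq_one h1
  have hfF : ∀ x, f x ≤ F x := fun x => rpow_one_add_le hε (hF x) (hF1 x)
  have hsplit : F v ^ 2 + ∑ w ∈ univ.erase v, F w ^ 2 = 1 := by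
    rw [add_sum_erase _ (fun w => F w ^ 2) (mem_univ v), h1]
  have hhalf : ∀ w ∈ univ.erase v, F w ^ 2 ≤ 1 / 2 := by
    intro w hw
    have h2 := single_le_sum (f := fun x => F x ^ 2) (fun y _ => sq_nonneg (F y)) hw
    have h3 : F w ^ 2 ≤ F v ^ 2 := pow_le_pow_left₀ (hF w) (hv w (mem_univ w)) 2
    linarith
  have hdecomp : ∑ x, ∑ y, f x * f y * expKernel ρ x y
      = f v ^ 2 + 2 * ∑ w ∈ univ.erase v, f v * f w * expKernel ρ v w
        + ∑ x ∈ univ.erase v, ∑ y ∈ univ.erase v, f x * f y * expKernel ρ x y := by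
    rw [← add_sum_erase _ _ (mem_univ v), ← add_sum_erase _ _ (mem_univ v), expKernel_self]
    have h2 : ∀ x ∈ univ.erase v, ∑ y, f x * f y * expKernel ρ x y
        = f v * f x * expKernel ρ v x + ∑ y ∈ univ.erase v, f x * f y * expKernel ρ x y := by
      intro x _
      rw [← add_sum_erase _ _ (mem_univ v), expKernel_comm ρ x v, mul_comm (f x)]
    rw [sum_congr rfl h2, sum_add_distrib]
    ring
  have hschur := schur_test (s := univ.erase v) (k := fun x y : Fin m => expKernel ρ x y)
    (fun _ _ => expKernel_nonneg hρ0.le _ _) (fun _ _ => expKernel_comm _ _ _)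
    (fun x _ => sum_expKernel_le hρ0.le hρ1 (univ.erase v) x) f
  have hfv : f v ^ 2 ≤ F v ^ 2 := pow_le_pow_left₀ (hf0 v) (hfF v) 2
  have hrow : ∑ w ∈ univ.erase v, f v * f w * expKernel ρ v w
      ≤ ∑ w ∈ univ.erase v, f w * expKernel ρ v w := by
    refine sum_le_sum fun w _ => ?_
    have h2 : f v ≤ 1 := (hfF v).trans (hF1 v)
    exact mul_le_mul_of_nonneg_right (mul_le_of_le_one_left (hf0 w) h2)
      (expKernel_nonneg hρ0.le _ _)
  -- Because `f v ^ 2 ≤ F v ^ 2 = 1 - ∑ F w ^ 2` over `w ≠ v`, each off-peak entry has a term `-F w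
  -- ^ 2` available to offset its interaction with the peak and its Schur contribution.
  have hpt : ∑ w ∈ univ.erase v, (2 * (f w * expKernel ρ v w)
        + f w ^ 2 * (1 + 2 * (ρ / (1 - ρ))) - F w ^ 2)
      ≤ ∑ w ∈ univ.erase v, E * expKernel (ρ ^ 2) v w := by
    refine sum_le_sum fun w hw => ?_
    have h2 := hE (F w) (hF w) (hhalf w hw) (((v : ℕ) - w) + (w - v)) (by
      have : (w : ℕ) ≠ v := fun h => (mem_erase.1 hw).1 (Fin.ext h)
      omega)
    rw [mul_assoc 2] at h2
    exact h2
  have hρ2 : ρ ^ 2 < 1 := by nlinarith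
  have hlast := mul_le_mul_of_nonneg_left
    (sum_erase_expKernel_le (sq_nonneg ρ) hρ2 v) hE0
  rw [← mul_sum, sum_sub_distrib, sum_add_distrib, ← mul_sum] at hpt
  rw [hdecomp]
  linarith

/-- Bernoulli's inequality gives this gap, the source of the whole gain over `ℓ²`. -/
lemma one_sub_two_rpow_ge {s ε : ℝ} (hε0 : 0 ≤ ε) (hε1 : ε ≤ 1) (hs : s ^ 2 ≤ 1 / 2) :
    ε / 2 ≤ 1 - (s ^ 2) ^ ε := by
  have h1 : (s ^ 2) ^ ε ≤ (1 / 2 : ℝ) ^ ε := Real.rpow_le_rpow (sq_nonneg s) hs hε0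
  have h2 := rpow_one_add_le_one_add_mul_self (s := -(1 / 2)) (by norm_num) hε0 hε1
  norm_num at h2 h1 ⊢
  linarith

lemma rpow_one_add_sq {s ε : ℝ} (hs : 0 ≤ s) (hε : 0 ≤ ε) :
    (s ^ (1 + ε)) ^ 2 = s ^ 2 * (s ^ 2) ^ ε := by
  rw [Real.rpow_add_of_nonneg hs zero_le_one hε, Real.rpow_one, mul_pow]
  congr 1
  rw [← Real.rpow_natCast, ← Real.rpow_natCast, ← Real.rpow_mul hs, ← Real.rpow_mul hs, mul_comm]

/-- The diagonal and the Schur part of the pointwise inequality. -/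
lemma diagonal_le {s ε ρ : ℝ} (hs0 : 0 ≤ s) (hs : s ^ 2 ≤ 1 / 2) (hε0 : 0 < ε) (hε1 : ε ≤ 1)
    (hρ0 : 0 < ρ) (hρ : ρ ≤ ε / 16) :
    (s ^ (1 + ε)) ^ 2 * (1 + 2 * (ρ / (1 - ρ))) - s ^ 2 ≤ -(s ^ 2 * (1 - (s ^ 2) ^ ε) / 2) := by
  have hD := one_sub_two_rpow_ge hε0.le hε1 hs
  rw [rpow_one_add_sq hs0 hε0.le]
  have hρ' : 2 * (ρ / (1 - ρ)) ≤ ε / 4 := by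
    have : ρ / (1 - ρ) ≤ 2 * ρ := by
      rw [div_le_iff₀ (by linarith)]; nlinarith
    linarith
  set t := (s ^ 2) ^ ε
  have ht0 : 0 ≤ t := Real.rpow_nonneg (sq_nonneg s) _
  have hs2 := sq_nonneg s
  have h1 : t * (1 + 2 * (ρ / (1 - ρ))) - 1 ≤ -((1 - t) / 2) := by
    have : t * (2 * (ρ / (1 - ρ))) ≤ 1 * (ε / 4) :=
      mul_le_mul (by linarith) hρ' (by have : 0 < 1 - ρ := by linarith
                                       positivity) zero_le_one
    linarith
  nlinarith [mul_le_mul_of_nonneg_left h1 hs2]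

lemma two_mul_sub_sq_le {s x c : ℝ} (hc : 0 < c) : 2 * s * x - c * s ^ 2 ≤ x ^ 2 / c := by
  rw [le_div_iff₀ hc]
  nlinarith [sq_nonneg (c * s - x)]

lemma sq_div_one_sub_sq_le {ρ : ℝ} (hρ0 : 0 < ρ) (hρ : ρ ≤ 1 / 16) :
    2 * (ρ ^ 2 / (1 - ρ ^ 2)) ≤ 4 * ρ ^ 2 := by
  have : ρ ^ 2 / (1 - ρ ^ 2) ≤ 2 * ρ ^ 2 := by
    rw [div_le_iff₀ (by nlinarith)]
    nlinarith [mul_nonneg (sq_nonneg ρ) (by nlinarith : 0 ≤ 1 - 2 * ρ ^ 2)]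
  linarith

/-- The bound for small `ρ`. -/
lemma expKernel_hasPowerBound_of_le {ρ ε : ℝ} (hρ0 : 0 < ρ) (hε0 : 0 < ε) (hε1 : ε ≤ 1)
    (hρ : ρ ≤ ε / 16) (m : ℕ) :
    HasPowerBound ε (fun v w : Fin m => expKernel ρ v w) (1 + 16 * ρ ^ 2 / ε) := by
  have h := expKernel_hasPowerBound_of_pointwise (E := 4 / ε) hρ0 (by linarith) hε0.le
    (by positivity) (fun s hs0 hs k hk => ?_) m
  · refine h.mono ?_
    have := mul_le_mul_of_nonneg_left (sq_div_one_sub_sq_le hρ0 (by linarith))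
      (by positivity : 0 ≤ 4 / ε)
    calc _ ≤ 1 + 4 / ε * (4 * ρ ^ 2) := by linarith
      _ = _ := by ring
  · have h1 := diagonal_le hs0 hs hε0 hε1 hρ0 hρ
    have hD := one_sub_two_rpow_ge hε0.le hε1 hs
    have h2 : s ^ (1 + ε) ≤ s := rpow_one_add_le hε0.le hs0 (by nlinarith)
    have hr : 0 ≤ ρ ^ k := by positivity
    -- The gap `ε / 2`, halved by `diagonal_le`, leaves `-(ε / 4) s ^ 2` for completing the square;
    -- hence `E = 4 / ε`.
    have h3 := two_mul_sub_sq_le (s := s) (x := ρ ^ k) (by positivity : 0 < ε / 4)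
    have h4 : (ρ ^ k) ^ 2 / (ε / 4) = 4 / ε * (ρ ^ 2) ^ k := by
      rw [← pow_mul, ← pow_mul, mul_comm k]; field_simp
    rw [h4] at h3
    nlinarith [mul_le_mul_of_nonneg_right h2 hr, mul_le_mul_of_nonneg_left hD (sq_nonneg s)]

/-- The bound for very small `ρ`, with a logarithmic saving. -/
lemma expKernel_hasPowerBound_of_le_sq {ρ ε : ℝ} (hρ0 : 0 < ρ) (hε0 : 0 < ε) (hε1 : ε ≤ 1)
    (hρ : ρ ≤ ε ^ 2 / 64) (m : ℕ) :
    HasPowerBound ε (fun v w : Fin m => expKernel ρ v w)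
      (1 + 8 * ρ ^ 2 / (ε * Real.log (1 / ρ))) := by
  have hρε : ρ ≤ ε / 16 := by nlinarith
  have hlog : 0 < Real.log (1 / ρ) := Real.log_pos (by rw [lt_div_iff₀ hρ0]; linarith)
  have hx : 0 < ε * Real.log (1 / ρ) := mul_pos hε0 hlog
  have hρe : ρ ^ ε = Real.exp (-(ε * Real.log (1 / ρ))) := by
    rw [Real.rpow_def_of_pos hρ0, one_div, Real.log_inv]; ring_nf
  have hgap : ρ ^ ε * (ε * Real.log (1 / ρ)) ≤ 1 - ρ ^ ε := by
    rw [hρe]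
    have h1 := Real.add_one_le_exp (ε * Real.log (1 / ρ))
    have h2 : Real.exp (-(ε * Real.log (1 / ρ))) * Real.exp (ε * Real.log (1 / ρ)) = 1 := by
      rw [← Real.exp_add]; simp
    nlinarith [Real.exp_pos (-(ε * Real.log (1 / ρ)))]
  have hρp : 0 < ρ ^ ε := Real.rpow_pos_of_pos hρ0 _
  have hD0 : 0 < 1 - ρ ^ ε := lt_of_lt_of_le (mul_pos hρp hx) hgap
  have h := expKernel_hasPowerBound_of_pointwise (E := 2 / (ε * Real.log (1 / ρ))) hρ0
    (by linarith) hε0.le (by positivity) (fun s hs0 hs k hk => ?_) m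
  · refine h.mono ?_
    have := mul_le_mul_of_nonneg_left (sq_div_one_sub_sq_le hρ0 (by linarith))
      (by positivity : 0 ≤ 2 / (ε * Real.log (1 / ρ)))
    calc _ ≤ 1 + 2 / (ε * Real.log (1 / ρ)) * (4 * ρ ^ 2) := by linarith
      _ = _ := by ring
  · have h1 := diagonal_le hs0 hs hε0 hε1 hρ0 hρε
    have hD := one_sub_two_rpow_ge hε0.le hε1 hs
    have hr : 0 < ρ ^ k := by positivity
    have hrρ : ρ ^ k ≤ ρ := by
      simpa using pow_le_pow_of_le_one hρ0.le (by linarith : ρ ≤ 1) hk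
    have hR : 0 ≤ 2 / (ε * Real.log (1 / ρ)) * (ρ ^ 2) ^ k := by positivity
    -- For large `s` the gap `ε s ^ 2 / 4` already beats the cross term. For small `s` the factor `s
    -- ^ ε ≤ ρ ^ (ε / 2)` weakens the cross term and the gap grows to `1 - ρ ^ ε`; the ratio `ρ ^ ε
    -- / (1 - ρ ^ ε)` is at most `1 / (ε log (1/ρ))`.
    by_cases hsr : ρ ^ k ≤ s ^ 2
    · have h2 : s ^ (1 + ε) ≤ s := rpow_one_add_le hε0.le hs0 (by nlinarith)
      have h3 : ρ ^ k * 8 ≤ s * ε := by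
        refine le_of_sq_le_sq ?_ (by positivity)
        have : ρ ^ k * 64 ≤ ε ^ 2 := by linarith
        calc (ρ ^ k * 8) ^ 2 = ρ ^ k * (ρ ^ k * 64) := by ring
          _ ≤ s ^ 2 * ε ^ 2 := mul_le_mul hsr this (by positivity) (sq_nonneg s)
          _ = _ := by ring
      nlinarith [mul_le_mul_of_nonneg_right h2 hr.le, mul_le_mul_of_nonneg_left hD (sq_nonneg s),
        mul_le_mul_of_nonneg_left h3 hs0]
    · push Not at hsr
      have h2 : (s ^ 2) ^ ε ≤ ρ ^ ε :=
        Real.rpow_le_rpow (sq_nonneg s) (hsr.le.trans hrρ) hε0.le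
      have h3 : s ^ (1 + ε) ≤ s * √(ρ ^ ε) := by
        refine le_of_sq_le_sq ?_ (by positivity)
        rw [rpow_one_add_sq hs0 hε0.le, mul_pow, Real.sq_sqrt hρp.le]
        exact mul_le_mul_of_nonneg_left h2 (sq_nonneg s)
      have h4 := two_mul_sub_sq_le (s := s) (x := √(ρ ^ ε) * ρ ^ k)
        (by positivity : 0 < (1 - ρ ^ ε) / 2)
      have h5 : (√(ρ ^ ε) * ρ ^ k) ^ 2 / ((1 - ρ ^ ε) / 2)
          ≤ 2 / (ε * Real.log (1 / ρ)) * (ρ ^ 2) ^ k := by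
        rw [mul_pow, Real.sq_sqrt hρp.le, ← pow_mul, ← pow_mul, mul_comm k 2,
          div_mul_eq_mul_div, div_le_div_iff₀ (by positivity) hx]
        have := mul_le_mul_of_nonneg_right hgap (by positivity : 0 ≤ ρ ^ (2 * k))
        linarith
      nlinarith [mul_le_mul_of_nonneg_right h3 hr.le, mul_le_mul_of_nonneg_left h2 (sq_nonneg s)]

/-! ### Euler product and reduction to local bounds. -/

/-- The GCD kernel is the power `-α` of this integer; in truncated subtraction its exponent at `p`
is the distance between the two valuations. -/
lemma factorization_div_gcd_mul_div_gcd {a b : ℕ} (ha : a ≠ 0) (hb : b ≠ 0) (p : ℕ) :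
    ((a / a.gcd b) * (b / a.gcd b)).factorization p
      = (a.factorization p - b.factorization p) + (b.factorization p - a.factorization p) := by
  have hg : 0 < a.gcd b := Nat.gcd_pos_of_pos_left _ (Nat.pos_of_ne_zero ha)
  have h1 : a / a.gcd b ≠ 0 :=
    (Nat.div_pos (Nat.le_of_dvd (Nat.pos_of_ne_zero ha) (Nat.gcd_dvd_left a b)) hg).ne'
  have h2 : b / a.gcd b ≠ 0 :=
    (Nat.div_pos (Nat.le_of_dvd (Nat.pos_of_ne_zero hb) (Nat.gcd_dvd_right a b)) hg).ne'
  rw [Nat.factorization_mul h1 h2, Nat.factorization_div (Nat.gcd_dvd_left a b),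
    Nat.factorization_div (Nat.gcd_dvd_right a b), Nat.factorization_gcd ha hb]
  simp only [Finsupp.add_apply, Finsupp.tsub_apply, Finsupp.inf_apply]
  omega

/-- The GCD kernel is an Euler product of exponential kernels in the `p`-adic valuations. -/
lemma gcd_kernel_eq_prod {a b : ℕ} (ha : a ≠ 0) (hb : b ≠ 0) (α : ℝ) {P : Finset ℕ}
    (hPa : a.primeFactors ⊆ P) (hPb : b.primeFactors ⊆ P) :
    (Nat.gcd a b : ℝ) ^ (2 * α) / ((a : ℝ) * (b : ℝ)) ^ α
      = ∏ p ∈ P, expKernel ((p : ℝ) ^ (-α)) (a.factorization p) (b.factorization p) := by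
  have hg : 0 < a.gcd b := Nat.gcd_pos_of_pos_left _ (Nat.pos_of_ne_zero ha)
  have hgR : (0 : ℝ) < a.gcd b := by exact_mod_cast hg
  have haR : (0 : ℝ) < a := by exact_mod_cast Nat.pos_of_ne_zero ha
  have hbR : (0 : ℝ) < b := by exact_mod_cast Nat.pos_of_ne_zero hb
  set n := (a / a.gcd b) * (b / a.gcd b) with hn
  have hnR : (n : ℝ) = a * b / (a.gcd b : ℝ) ^ 2 := by
    rw [hn, Nat.cast_mul, Nat.cast_div (Nat.gcd_dvd_left a b) hgR.ne',
      Nat.cast_div (Nat.gcd_dvd_right a b) hgR.ne']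
    field_simp
  have hnpos : (0 : ℝ) < n := by rw [hnR]; positivity
  have hn0 : n ≠ 0 := by
    rintro h; rw [h] at hnpos; simp at hnpos
  have h1 : (Nat.gcd a b : ℝ) ^ (2 * α) / ((a : ℝ) * (b : ℝ)) ^ α = (n : ℝ) ^ (-α) := by
    rw [hnR, Real.rpow_neg (by positivity), Real.div_rpow (by positivity) (by positivity), inv_div,
      Real.rpow_mul hgR.le, Real.rpow_two]
  have h2 : n = ∏ p ∈ P, p ^ n.factorization p := by
    conv_lhs => rw [← Nat.prod_factorization_pow_eq_self hn0]
    refine Finsupp.prod_of_support_subset _ ?_ _ (by simp)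
    intro p hp
    rw [Finsupp.mem_support_iff, factorization_div_gcd_mul_div_gcd ha hb] at hp
    by_cases h : a.factorization p = 0
    · refine hPb ?_
      rw [← Nat.support_factorization, Finsupp.mem_support_iff]
      omega
    · refine hPa ?_
      rwa [← Nat.support_factorization, Finsupp.mem_support_iff]
  rw [h1]
  conv_lhs => rw [h2]
  rw [Nat.cast_prod, ← Real.finsetProd_rpow _ _ (fun p _ => by positivity)]
  refine prod_congr rfl fun p _ => ?_
  rw [expKernel, Nat.cast_pow, factorization_div_gcd_mul_div_gcd ha hb, ← Real.rpow_natCast,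
    ← Real.rpow_natCast, ← Real.rpow_mul (by positivity), ← Real.rpow_mul (by positivity), mul_comm]

lemma norm_gcdSum_le_sum (d : ℕ) (α : ℝ) (f : (Fin d → ℕ+) →₀ ℂ) :
    ‖gcdSum d α f‖ ≤ ∑ a ∈ f.support, ∑ b ∈ f.support, ‖f a‖ * ‖f b‖ *
      ∏ i : Fin d, ((Nat.gcd (a i : ℕ) (b i : ℕ) : ℝ) ^ (2 * α) /
        (((a i : ℕ) : ℝ) * ((b i : ℕ) : ℝ)) ^ α) := by
  refine (norm_sum_le _ _).trans (sum_le_sum fun a _ => (norm_sum_le _ _).trans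
    (sum_le_sum fun b _ => le_of_eq ?_))
  rw [norm_mul, norm_mul, RCLike.norm_conj, Complex.norm_real, Real.norm_of_nonneg]
  exact prod_nonneg fun i _ => by positivity

/-- The GCD sum is bounded by the Euler product of the local bounds, up to the loss `K ^ ε` from
comparing the norms of `ℓ^q` and `ℓ²`. -/
theorem norm_gcdSum_le {d : ℕ} {α ε B : ℝ} (hε : 0 ≤ ε) {g : ℕ → ℝ}
    (hg : ∀ p : ℕ, p.Prime → ∀ m : ℕ,
      HasPowerBound ε (fun v w : Fin m => expKernel ((p : ℝ) ^ (-α)) v w) (Real.exp (g p)))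
    (hB : ∀ P : Finset ℕ, (∀ p ∈ P, p.Prime) → ∑ p ∈ P, g p ≤ B) (f : (Fin d → ℕ+) →₀ ℂ) :
    ‖gcdSum d α f‖ ≤ Real.exp (d * B) * (f.support.card : ℝ) ^ ε * l2Norm f ^ 2 := by
  classical
  set P : Finset ℕ := f.support.biUnion fun a => univ.biUnion fun i => (a i : ℕ).primeFactors
  have hP : ∀ p ∈ P, p.Prime := by
    intro p hp
    simp only [P, mem_biUnion] at hp
    obtain ⟨a, -, i, -, h⟩ := hp
    exact Nat.prime_of_mem_primeFactors h
  have hsub : ∀ a ∈ f.support, ∀ i, (a i : ℕ).primeFactors ⊆ P := by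
    intro a ha i p hp
    simp only [P, mem_biUnion]
    exact ⟨a, ha, i, mem_univ _, hp⟩
  set m : ℕ := ∑ a ∈ f.support, ∑ i, (a i : ℕ) with hm
  have hlt : ∀ a ∈ f.support, ∀ i p, (a i : ℕ).factorization p < m := by
    intro a ha i p
    refine (Nat.factorization_lt p (a i).ne_zero).trans_le ?_
    refine le_trans ?_ (single_le_sum (f := fun a : Fin d → ℕ+ => ∑ i, (a i : ℕ))
      (fun _ _ => Nat.zero_le _) ha)
    exact single_le_sum (f := fun i => (a i : ℕ)) (fun _ _ => Nat.zero_le _) (mem_univ i)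
  let φ : {a // a ∈ f.support} → (Fin d × {p // p ∈ P}) → Fin m := fun a ip =>
    ⟨(a.1 ip.1 : ℕ).factorization ip.2.1, hlt a.1 a.2 _ _⟩
  have hφ : Function.Injective φ := by
    intro a b hab
    refine Subtype.ext (funext fun i => PNat.coe_injective ?_)
    refine Nat.eq_of_factorization_eq (a.1 i).ne_zero (b.1 i).ne_zero fun p => ?_
    by_cases hp : p ∈ P
    · have h := congrFun hab (i, ⟨p, hp⟩)
      simpa [φ] using h
    · have h : ∀ c : {a // a ∈ f.support}, (c.1 i : ℕ).factorization p = 0 := fun c => by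
        rw [← Finsupp.notMem_support_iff, Nat.support_factorization]
        exact fun h => hp (hsub c.1 c.2 i h)
      rw [h a, h b]
  have hpi := (HasPowerBound.pi hε
    (fun (ip : Fin d × {p // p ∈ P}) (v w : Fin m) => expKernel ((ip.2.1 : ℝ) ^ (-α)) v w)
    (fun ip => Real.exp (g ip.2.1)) (fun _ _ _ => expKernel_nonneg (by positivity) _ _)
    (fun _ => (Real.exp_pos _).le) (fun ip => hg _ (hP _ ip.2.2) m)).comp_injective hε hφ
  have hconst : ∏ ip : Fin d × {p // p ∈ P}, Real.exp (g ip.2.1) ≤ Real.exp (d * B) := by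
    rw [← Real.exp_sum, Fintype.sum_prod_type]
    simp only [sum_const, card_univ, Fintype.card_fin, nsmul_eq_mul]
    rw [Finset.sum_coe_sort P g]
    gcongr
    exact hB P hP
  have hε1 : 0 < 1 + ε := by linarith
  set F : {a // a ∈ f.support} → ℝ := fun a => ‖f a.1‖ ^ (1 / (1 + ε)) with hF
  have hF0 : ∀ a, 0 ≤ F a := fun a => Real.rpow_nonneg (norm_nonneg _) _
  have hFpow : ∀ a, F a ^ (1 + ε) = ‖f a.1‖ := fun a => by
    simp only [hF]
    rw [← Real.rpow_mul (norm_nonneg _), one_div_mul_cancel hε1.ne', Real.rpow_one]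
  have hl2 : l2Norm f ^ 2 = ∑ a : {a // a ∈ f.support}, ‖f a.1‖ ^ 2 := by
    rw [l2Norm, Real.sq_sqrt (sum_nonneg fun _ _ => sq_nonneg _),
      Finset.sum_coe_sort f.support fun a => ‖f a‖ ^ 2]
  -- The power mean inequality on the support; this is where `K ^ ε` enters.
  have hnorm : (√(∑ a, F a ^ 2) * √(∑ a, F a ^ 2)) ^ (1 + ε)
      ≤ (f.support.card : ℝ) ^ ε * l2Norm f ^ 2 := by
    rw [Real.mul_self_sqrt (sum_nonneg fun _ _ => sq_nonneg _), hl2]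
    have h := Real.rpow_sum_le_const_mul_sum_rpow_of_nonneg (s := univ) (f := fun a => F a ^ 2)
      (by linarith : 1 ≤ 1 + ε) fun a _ => sq_nonneg _
    simp only [card_univ, Fintype.card_coe, add_sub_cancel_left] at h
    refine h.trans (le_of_eq ?_)
    congr 1
    refine sum_congr rfl fun a _ => ?_
    rw [← hFpow a, ← Real.rpow_two, ← Real.rpow_mul (hF0 a), ← Real.rpow_two,
      ← Real.rpow_mul (hF0 a), mul_comm]
  have hmain := hpi F F hF0 hF0
  refine (norm_gcdSum_le_sum d α f).trans ?_
  rw [mul_assoc]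
  refine le_trans (le_of_eq ?_) (hmain.trans (mul_le_mul hconst hnorm
    (Real.rpow_nonneg (mul_nonneg (Real.sqrt_nonneg _) (Real.sqrt_nonneg _)) _)
    (Real.exp_pos _).le))
  rw [← Finset.sum_coe_sort f.support]
  refine sum_congr rfl fun a _ => ?_
  rw [← Finset.sum_coe_sort f.support]
  refine sum_congr rfl fun b _ => ?_
  rw [hFpow, hFpow]
  beta_reduce
  rw [Fintype.prod_prod_type]
  congr 1
  refine prod_congr rfl fun i _ => ?_
  rw [gcd_kernel_eq_prod (a.1 i).ne_zero (b.1 i).ne_zero α (hsub a.1 a.2 i) (hsub b.1 b.2 i),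
    ← Finset.prod_coe_sort P]

/-! ### Sums over primes by dyadic blocks. -/

/-- Chebyshev's bound for the number of primes in a dyadic block. -/
lemma card_primes_log_two_eq_mul_le {P : Finset ℕ} (hP : ∀ p ∈ P, p.Prime) (j : ℕ) :
    j * (P.filter fun p => Nat.log 2 p = j).card ≤ 4 * 2 ^ j := by
  set S := P.filter fun p => Nat.log 2 p = j
  -- The product of the block lies between `(2 ^ j) ^ S.card` and `4 ^ (2 ^ (j + 1))`; compare
  -- exponents of 2.
  have h1 : (2 ^ j) ^ S.card ≤ ∏ p ∈ S, p := by
    rw [← prod_const]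
    refine prod_le_prod' fun p hp => ?_
    obtain ⟨hp1, hp2⟩ := mem_filter.1 hp
    rw [← hp2]
    exact Nat.pow_log_le_self 2 (hP p hp1).ne_zero
  have h2 : ∏ p ∈ S, p ≤ primorial (2 ^ (j + 1)) := by
    unfold primorial
    refine prod_le_prod_of_subset_of_one_le' ?_ ?_
    · intro p hp
      obtain ⟨hp1, hp2⟩ := mem_filter.1 hp
      have h3 := Nat.lt_pow_succ_log_self one_lt_two p
      rw [hp2] at h3
      simp only [mem_filter, mem_range]
      exact ⟨by omega, hP p hp1⟩
    · intro p hp _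
      have : p.Prime := by
        simp only [mem_filter, mem_range] at hp
        exact hp.2
      exact this.one_le
  have h3 := (h1.trans h2).trans (primorial_le_four_pow _)
  rw [← pow_mul, show 4 = 2 ^ 2 from rfl, ← pow_mul, Nat.pow_le_pow_iff_right one_lt_two] at h3
  rw [pow_succ] at h3
  omega

/-- Block `j` holds at most `4 * 2 ^ j / j` primes, and block 0 is empty because primes are at least
2. -/
lemma sum_primes_le_of_dyadic {P : Finset ℕ} (hP : ∀ p ∈ P, p.Prime) {G : ℕ → ℝ} {B : ℝ}
    (hG : ∀ j, 0 ≤ G j) (hB : ∀ J : ℕ, ∑ j ∈ Icc 1 J, 4 * 2 ^ j / j * G j ≤ B) :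
    ∑ p ∈ P, G (Nat.log 2 p) ≤ B := by
  refine le_trans ?_ (hB (P.sup (Nat.log 2)))
  have hmap : ∀ p ∈ P, Nat.log 2 p ∈ Icc 1 (P.sup (Nat.log 2)) := fun p hp =>
    mem_Icc.2 ⟨Nat.log_pos one_lt_two (hP p hp).two_le, le_sup hp⟩
  rw [← sum_fiberwise_of_maps_to hmap]
  refine sum_le_sum fun j hj => ?_
  have hj1 : (0 : ℝ) < j := by exact_mod_cast (mem_Icc.1 hj).1
  rw [sum_congr rfl (fun p hp => by rw [(mem_filter.1 hp).2]), sum_const, nsmul_eq_mul]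
  refine mul_le_mul_of_nonneg_right ?_ (hG j)
  rw [le_div_iff₀ hj1, mul_comm]
  exact_mod_cast card_primes_log_two_eq_mul_le hP j

/-- `B` bounds the logarithm of the norm of the local kernel at all primes `p` with `p ^ (-α) ≤ r`.
The three alternatives are the trivial bound, the bound for small `r` and the one with a
logarithmic saving. -/
def IsLocalBound (ε r B : ℝ) : Prop :=
  7 * r ≤ B ∨ (r ≤ ε / 16 ∧ 16 * r ^ 2 / ε ≤ B) ∨
    (r ≤ ε ^ 2 / 64 ∧ 8 * r ^ 2 / (ε * Real.log (1 / r)) ≤ B)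

lemma IsLocalBound.hasPowerBound {ε r ρ B : ℝ} (hε0 : 0 < ε) (hε1 : ε ≤ 1) (hρ0 : 0 < ρ)
    (hρ : ρ ≤ 5 / 7) (hr : ρ ≤ r) (h : IsLocalBound ε r B) (m : ℕ) :
    HasPowerBound ε (fun v w : Fin m => expKernel ρ v w) (Real.exp B) := by
  have hexp : ∀ {t : ℝ}, t ≤ B → 1 + t ≤ Real.exp B := fun {t} ht => by
    have := Real.add_one_le_exp B
    linarith
  rcases h with h | ⟨h1, h2⟩ | ⟨h1, h2⟩
  · refine (expKernel_hasPowerBound_trivial hρ0 (by linarith) hε0.le m).mono (hexp ?_)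
    have : ρ / (1 - ρ) ≤ 7 / 2 * ρ := by
      rw [div_le_iff₀ (by linarith)]; nlinarith
    linarith
  · refine (expKernel_hasPowerBound_of_le hρ0 hε0 hε1 (hr.trans h1) m).mono (hexp ?_)
    refine le_trans ?_ h2
    gcongr
  · refine (expKernel_hasPowerBound_of_le_sq hρ0 hε0 hε1 (hr.trans h1) m).mono (hexp ?_)
    refine le_trans ?_ h2
    have hr0 : 0 < r := hρ0.trans_le hr
    have : 0 < Real.log (1 / r) := Real.log_pos (by rw [lt_div_iff₀ hr0]; nlinarith)
    gcongr

/-- The value `5/7` is a rational just above `1/√2`; it makes `2ρ / (1 - ρ) ≤ 7ρ`, the constant of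
the trivial local bound. -/
lemma two_rpow_neg_le {α : ℝ} (hα : 1 / 2 ≤ α) : (2 : ℝ) ^ (-α) ≤ 5 / 7 := by
  have h1 : (2 : ℝ) ^ (-α) ≤ 2 ^ (-(1 / 2) : ℝ) :=
    Real.rpow_le_rpow_of_exponent_le one_le_two (by linarith)
  refine h1.trans ?_
  rw [Real.rpow_neg two_pos.le, ← Real.sqrt_eq_rpow, inv_le_comm₀ (by positivity) (by norm_num)]
  exact Real.le_sqrt_of_sq_le (by norm_num)

lemma prime_rpow_neg_le {α : ℝ} (hα : 0 ≤ α) {p : ℕ} (hp : p.Prime) :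
    (p : ℝ) ^ (-α) ≤ ((2 : ℝ) ^ (-α)) ^ Nat.log 2 p := by
  have h1 : ((2 : ℝ) ^ Nat.log 2 p) ≤ p := by
    exact_mod_cast Nat.pow_log_le_self 2 hp.ne_zero
  have h2 := Real.rpow_le_rpow_of_nonpos (by positivity) h1 (by linarith : -α ≤ 0)
  refine h2.trans (le_of_eq ?_)
  rw [← Real.rpow_natCast, ← Real.rpow_natCast, ← Real.rpow_mul two_pos.le,
    ← Real.rpow_mul two_pos.le, mul_comm]

/-- The bound for GCD sums in terms of local bounds on dyadic blocks of primes. -/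
theorem norm_gcdSum_le_of_dyadic {d : ℕ} {α ε B : ℝ} (hα : 1 / 2 ≤ α) (hε0 : 0 < ε) (hε1 : ε ≤ 1)
    {G : ℕ → ℝ} (hG0 : ∀ j, 0 ≤ G j)
    (hG : ∀ j : ℕ, 1 ≤ j → IsLocalBound ε (((2 : ℝ) ^ (-α)) ^ j) (G j))
    (hB : ∀ J : ℕ, ∑ j ∈ Icc 1 J, 4 * 2 ^ j / j * G j ≤ B) (f : (Fin d → ℕ+) →₀ ℂ) :
    ‖gcdSum d α f‖ ≤ Real.exp (d * B) * (f.support.card : ℝ) ^ ε * l2Norm f ^ 2 := by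
  refine norm_gcdSum_le (g := fun p => G (Nat.log 2 p)) hε0.le (fun p hp m => ?_)
    (fun P hP => sum_primes_le_of_dyadic hP hG0 hB) f
  have hlog := Nat.log_pos one_lt_two hp.two_le
  have hle := prime_rpow_neg_le (by linarith : 0 ≤ α) hp
  refine (hG _ hlog).hasPowerBound hε0 hε1 (Real.rpow_pos_of_pos (by exact_mod_cast hp.pos) _) ?_
    hle m
  have h2 := two_rpow_neg_le hα
  exact hle.trans ((pow_le_of_le_one (by positivity) (by linarith) (by omega)).trans h2)

lemma sum_Icc_ite_le {u v : ℕ → ℝ} (hu : ∀ j, 0 ≤ u j) (hv : ∀ j, 0 ≤ v j) (J₀ J : ℕ) :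
    ∑ j ∈ Icc 1 J, (if j ≤ J₀ then u j else v j)
      ≤ ∑ j ∈ Icc 1 J₀, u j + ∑ j ∈ Ioc J₀ J, v j := by
  rw [sum_ite]
  refine add_le_add ?_ ?_ <;>
  refine sum_le_sum_of_subset_of_nonneg ?_ (fun j _ _ => by first | exact hu j | exact hv j) <;>
  · intro j hj
    simp only [mem_filter, mem_Icc, mem_Ioc] at hj ⊢
    omega

lemma sum_Ioc_pow_le {x : ℝ} (hx0 : 0 ≤ x) (hx1 : x < 1) (J₀ J : ℕ) :
    ∑ j ∈ Ioc J₀ J, x ^ j ≤ x ^ J₀ * (x / (1 - x)) := by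
  have h := mul_le_mul_of_nonneg_left (sum_Ico_pow_sub_le hx0 hx1 J₀ (J + 1))
    (pow_nonneg hx0 J₀)
  refine le_trans (le_of_eq ?_) h
  rw [mul_sum]
  refine sum_congr (by ext; simp only [mem_Ioc, mem_Ico]; omega) fun j hj => ?_
  rw [← pow_add]
  congr 1
  have := (mem_Ico.1 hj).1
  omega

/-- The last term dominates: `J / j ≤ 1 + (J - j)`, so reading the sum backwards gives a convergent
series in `z⁻¹`. -/
lemma exists_sum_pow_div_le {z : ℝ} (hz : 1 < z) :
    ∃ C : ℝ, 0 < C ∧ ∀ J : ℕ, 1 ≤ J → ∑ j ∈ Icc 1 J, z ^ j / j ≤ C * (z ^ J / J) := by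
  have hz0 : 0 < z := by linarith
  have hs : Summable fun k : ℕ => (1 + (k : ℝ)) * z⁻¹ ^ k := by
    have hlt : ‖z⁻¹‖ < 1 := by
      rw [Real.norm_of_nonneg (by positivity)]; exact inv_lt_one_of_one_lt₀ hz
    have h1 := summable_pow_mul_geometric_of_norm_lt_one 1 hlt
    have h0 := summable_pow_mul_geometric_of_norm_lt_one 0 hlt
    refine (h0.add h1).congr fun k => ?_
    simp; ring
  refine ⟨∑' k : ℕ, (1 + (k : ℝ)) * z⁻¹ ^ k, ?_, fun J hJ => ?_⟩
  · exact hs.tsum_pos (fun k => by positivity) 0 (by simp)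
  · have hJ0 : (0 : ℝ) < J := by exact_mod_cast hJ
    have h1 : ∑ j ∈ Icc 1 J, z ^ j / j
        ≤ ∑ j ∈ Icc 1 J, (1 + ((J - j : ℕ) : ℝ)) * z⁻¹ ^ (J - j) * (z ^ J / J) := by
      refine sum_le_sum fun j hj => ?_
      obtain ⟨hj1, hj2⟩ := mem_Icc.1 hj
      have hj0 : (1 : ℝ) ≤ j := by exact_mod_cast hj1
      have hjJ : (j : ℝ) ≤ J := by exact_mod_cast hj2
      have hpow : z⁻¹ ^ (J - j) * z ^ J = z ^ j := by
        rw [inv_pow, inv_mul_eq_div, div_eq_iff (by positivity), ← pow_add]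
        congr 1; omega
      rw [mul_assoc, ← mul_div_assoc, hpow, Nat.cast_sub hj2, ← mul_div_assoc,
        div_le_div_iff₀ (by linarith) hJ0, mul_comm (1 + _), mul_assoc]
      refine mul_le_mul_of_nonneg_left ?_ (by positivity)
      nlinarith [mul_nonneg (sub_nonneg.2 hjJ) (sub_nonneg.2 hj0)]
    rw [← sum_mul] at h1
    refine h1.trans (mul_le_mul_of_nonneg_right ?_ (by positivity))
    have h2 : ∑ j ∈ Icc 1 J, (1 + ((J - j : ℕ) : ℝ)) * z⁻¹ ^ (J - j)
        = ∑ k ∈ range J, (1 + (k : ℝ)) * z⁻¹ ^ k := by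
      refine sum_nbij' (fun j => J - j) (fun k => J - k) ?_ ?_ ?_ ?_ ?_ <;>
        simp only [mem_Icc, mem_range] <;> intros <;> first | omega | trivial
    rw [h2]
    exact hs.sum_le_tsum _ fun k _ => by positivity

/-- A power of two in `(Y, 2Y]`. -/
lemma exists_two_pow_near {Y : ℝ} (hY : 1 ≤ Y) : ∃ J : ℕ, 1 ≤ J ∧ Y < 2 ^ J ∧ 2 ^ J ≤ 2 * Y := by
  obtain ⟨n, h1, h2⟩ := exists_nat_pow_near hY one_lt_two
  exact ⟨n + 1, by omega, h2, by rw [pow_succ]; linarith⟩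

lemma sum_Icc_inv_le_one_add_log (J : ℕ) : ∑ j ∈ Icc 1 J, (1 : ℝ) / j ≤ 1 + Real.log J := by
  have h := harmonic_le_one_add_log J
  rw [harmonic_eq_sum_Icc] at h
  push_cast at h
  simpa only [one_div] using h

lemma card_rpow_eq_exp {K : ℕ} (hK : 0 < K) (ε : ℝ) :
    (K : ℝ) ^ ε = Real.exp (Real.log K * ε) :=
  Real.rpow_def_of_pos (by exact_mod_cast hK) _

lemma one_le_log_of_three_le {x : ℝ} (hx : 3 ≤ x) : 1 < Real.log x := by
  rw [Real.lt_log_iff_exp_lt (by linarith)]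
  linarith [Real.exp_one_lt_d9]

lemma loglog_three_pos : 0 < Real.log (Real.log 3) :=
  Real.log_pos (one_le_log_of_three_le le_rfl)

lemma loglog_three_le {x : ℝ} (hx : 3 ≤ x) :
    Real.log (Real.log 3) ≤ Real.log (Real.log x) :=
  Real.log_le_log (by linarith [one_le_log_of_three_le (le_refl 3)])
    (Real.log_le_log (by norm_num) hx)

/-! ### Choice of `ε` in the three ranges of `α`. -/

/-- Gál's bound in the case `α = 1`. -/
theorem gcdSum_one_bound (d : ℕ) (hd : 1 ≤ d) :
    ∃ A : ℝ, 0 < A ∧ ∃ M : ℝ, 0 < M ∧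
      ∀ f : (Fin d → ℕ+) →₀ ℂ, 3 ≤ f.support.card →
        ‖gcdSum d 1 f‖ ≤
          M * Real.log (Real.log (f.support.card : ℝ)) ^ A * l2Norm f ^ 2 := by
  have hd0 : (0 : ℝ) < d := by exact_mod_cast hd
  -- The cutoff satisfies `J₀ ≤ 5 + 2 log L`; the lower bound `log L ≥ loglog 3` turns this into `J₀
  -- ≤ c log L`.
  set c : ℝ := 5 / Real.log (Real.log 3) + 2
  have hc : 0 < c := by have := loglog_three_pos; positivity
  refine ⟨28 * d, by positivity, Real.exp (d * (32 + 28 * Real.log c) + 1), Real.exp_pos _,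
    fun f hK => ?_⟩
  have hKR : (3 : ℝ) ≤ f.support.card := by exact_mod_cast hK
  set L := Real.log (f.support.card : ℝ) with hLdef
  have hL : 1 < L := one_le_log_of_three_le hKR
  have hℓ0 : 0 < Real.log L := Real.log_pos hL
  have hℓ : Real.log (Real.log 3) ≤ Real.log L := loglog_three_le hKR
  -- Past this cutoff `ρ ≤ 1 / (16 L) = ε / 16` with `ε = 1 / L`, a choice that makes `K ^ ε = e`.
  obtain ⟨J₀, hJ1, hJlt, hJle⟩ := exists_two_pow_near (by linarith : 1 ≤ 16 * L)
  have hJlog : Real.log J₀ ≤ Real.log c + Real.log (Real.log L) := by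
    have hJ0R : (0 : ℝ) < J₀ := by exact_mod_cast hJ1
    rw [← Real.log_mul hc.ne' hℓ0.ne']
    refine Real.log_le_log hJ0R ?_
    have h1 := Real.log_le_log (by positivity) hJle
    rw [Real.log_pow, show 2 * (16 * L) = 2 ^ 5 * L by ring,
      Real.log_mul (by norm_num) (by linarith), Real.log_pow] at h1
    have h2 := Real.log_two_gt_d9
    have h3 : (J₀ : ℝ) ≤ 5 + 2 * Real.log L := by push_cast at h1; nlinarith
    have h4 : (5 : ℝ) ≤ 5 / Real.log (Real.log 3) * Real.log L := by
      rw [div_mul_eq_mul_div, le_div_iff₀ loglog_three_pos]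
      linarith
    calc (J₀ : ℝ) ≤ _ := h3
      _ ≤ c * Real.log L := by simp only [c]; linarith
  have hx : ((2 : ℝ) ^ (-1 : ℝ)) = 1 / 2 := by rw [Real.rpow_neg_one]; norm_num
  have hmain := norm_gcdSum_le_of_dyadic (d := d) (α := 1) (ε := 1 / L)
    (B := 28 * (1 + Real.log J₀) + 4) (by norm_num) (by positivity)
    (by rw [div_le_one (by linarith)]; exact hL.le)
    (G := fun j => if j ≤ J₀ then 7 * (1 / 2) ^ j else 16 * ((1 / 2) ^ j) ^ 2 / (1 / L))
    (fun j => by split_ifs <;> positivity) (fun j hj => ?_) (fun J => ?_) f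
  · refine hmain.trans ?_
    refine mul_le_mul_of_nonneg_right ?_ (sq_nonneg _)
    rw [card_rpow_eq_exp (by omega), mul_one_div_cancel (by positivity),
      Real.rpow_def_of_pos hℓ0, ← Real.exp_add, ← Real.exp_add, Real.exp_le_exp]
    have := mul_le_mul_of_nonneg_left hJlog hd0.le
    linarith
  · rw [hx]
    by_cases h : j ≤ J₀
    · left; rw [if_pos h]
    · right; left
      refine ⟨?_, by rw [if_neg h]⟩
      have h1 : (2 : ℝ) ^ J₀ ≤ 2 ^ j := pow_le_pow_right₀ one_le_two (by omega)
      rw [one_div_pow, div_div, one_div_le_one_div (by positivity) (by positivity)]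
      linarith
  · have h1 : ∀ j ∈ Icc 1 J, 4 * 2 ^ j / (j : ℝ) *
        (if j ≤ J₀ then 7 * (1 / 2) ^ j else 16 * ((1 / 2) ^ j) ^ 2 / (1 / L))
        ≤ if j ≤ J₀ then 28 * (1 / (j : ℝ)) else 64 * L * (1 / 2) ^ j := by
      intro j hj
      have hj1 : (1 : ℝ) ≤ j := by exact_mod_cast (mem_Icc.1 hj).1
      have h2 : (2 : ℝ) ^ j * (1 / 2) ^ j = 1 := by rw [← mul_pow]; norm_num
      split_ifs
      · refine le_of_eq ?_
        calc _ = 28 * (1 / (j : ℝ)) * ((2 : ℝ) ^ j * (1 / 2) ^ j) := by ring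
          _ = _ := by rw [h2, mul_one]
      · calc _ = 64 * L * (1 / 2) ^ j * ((2 : ℝ) ^ j * (1 / 2) ^ j) * (1 / j) := by
              field_simp; norm_num
          _ ≤ 64 * L * (1 / 2) ^ j * ((2 : ℝ) ^ j * (1 / 2) ^ j) * 1 := by
              gcongr
              rw [div_le_one (by linarith)]; exact hj1
          _ = _ := by rw [h2, mul_one, mul_one]
    refine (sum_le_sum h1).trans ((sum_Icc_ite_le (fun j => by positivity)
      (fun j => by positivity) J₀ J).trans (add_le_add ?_ ?_))
    · rw [← mul_sum]
      exact mul_le_mul_of_nonneg_left (sum_Icc_inv_le_one_add_log J₀) (by norm_num)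
    · rw [← mul_sum]
      have h2 := sum_Ioc_pow_le (by norm_num : (0 : ℝ) ≤ 1 / 2) (by norm_num) J₀ J
      have h3 : ((1 : ℝ) / 2) ^ J₀ ≤ 1 / (16 * L) := by
        rw [one_div_pow, one_div_le_one_div (by positivity) (by positivity)]
        exact hJlt.le
      calc _ ≤ 64 * L * (1 / (16 * L)) := by
            refine mul_le_mul_of_nonneg_left ?_ (by positivity)
            norm_num at h2 h3 ⊢
            linarith
        _ = 4 := by field_simp; norm_num

/-- The bound in the case `1/2 < α < 1`. -/
theorem gcdSum_bound_of_lt_one (d : ℕ) (hd : 1 ≤ d) (α : ℝ) (hα : 1 / 2 < α) (hα1 : α < 1) :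
    ∃ C : ℝ, 0 < C ∧ ∃ M : ℝ, 0 < M ∧
      ∀ f : (Fin d → ℕ+) →₀ ℂ, 3 ≤ f.support.card →
        ‖gcdSum d α f‖ ≤
          M * Real.exp (C * Real.log (f.support.card : ℝ) ^ (1 - α) *
            Real.log (Real.log (f.support.card : ℝ)) ^ (-α)) * l2Norm f ^ 2 := by
  have hd0 : (0 : ℝ) < d := by exact_mod_cast hd
  set z : ℝ := (2 : ℝ) ^ (1 - α) with hz
  have hz1 : 1 < z := Real.one_lt_rpow one_lt_two (by linarith)
  set w : ℝ := (2 : ℝ) ^ (1 - 2 * α) with hw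
  have hw0 : 0 < w := by positivity
  have hw1 : w < 1 := Real.rpow_lt_one_of_one_lt_of_neg one_lt_two (by linarith)
  have hww : 0 < w / (1 - w) := div_pos hw0 (by linarith)
  obtain ⟨C₁, hC₁, hsum⟩ := exists_sum_pow_div_le hz1
  set C₂ : ℝ := 28 * (C₁ * 512) + 64 * (w / (1 - w)) with hC₂
  refine ⟨d * C₂ + 1, by positivity, 1, one_pos, fun f hK => ?_⟩
  have hKR : (3 : ℝ) ≤ f.support.card := by exact_mod_cast hK
  set L := Real.log (f.support.card : ℝ) with hLdef
  have hL : 1 < L := one_le_log_of_three_le hKR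
  set l := Real.log L with hl
  have hl0 : 0 < l := Real.log_pos hL
  -- With `ε = y ^ (-α)` the loss `L ε`, the small primes `y ^ (1 - α) / log y` and the tail all
  -- have size `T`. The shift by 2 keeps `y ≥ L` for small `K`, where `l` is near 0.
  set y : ℝ := L * (l + 2) with hy
  have hLy : L ≤ y := by rw [hy]; nlinarith
  have hy1 : 1 ≤ y := by linarith
  have hy0 : 0 < y := by linarith
  set T : ℝ := L ^ (1 - α) * l ^ (-α) with hT
  have hTy : y ^ (1 - α) / (l + 2) ≤ T := by
    rw [hy, Real.mul_rpow (by linarith) (by linarith), mul_div_assoc, hT]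
    refine mul_le_mul_of_nonneg_left ?_ (by positivity)
    have h1 : (l + 2) ^ (1 - α) / (l + 2) = (l + 2) ^ (-α) := by
      rw [sub_eq_add_neg, Real.rpow_add (by linarith), Real.rpow_one]
      field_simp
    rw [h1]
    exact Real.rpow_le_rpow_of_nonpos hl0 (by linarith) (by linarith)
  set ε : ℝ := y ^ (-α) with hε
  have hε0 : 0 < ε := by positivity
  have hε1 : ε ≤ 1 := Real.rpow_le_one_of_one_le_of_nonpos hy1 (by linarith)
  have hLε : L * ε ≤ T := by
    have h1 : L * ε = L ^ (1 - α) * (l + 2) ^ (-α) := by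
      rw [hε, hy, Real.mul_rpow (by linarith) (by linarith), ← mul_assoc]
      congr 1
      rw [sub_eq_add_neg, Real.rpow_add (by linarith), Real.rpow_one]
    rw [h1, hT]
    refine mul_le_mul_of_nonneg_left ?_ (by positivity)
    exact Real.rpow_le_rpow_of_nonpos hl0 (by linarith) (by linarith)
  -- The factor 256 gives `(256 y) ^ (-α) ≤ ε / 16`, as `256 ^ (-1/2) = 1/16`.
  obtain ⟨J₀, hJ1, hJlt, hJle⟩ := exists_two_pow_near (by linarith : 1 ≤ 256 * y)
  have hJ0R : (0 : ℝ) < J₀ := by exact_mod_cast hJ1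
  -- Supplies the logarithm gained from the density of primes.
  have hJl : l + 2 ≤ J₀ := by
    have h1 := Real.log_le_log (by positivity) hJlt.le
    have h3 : Real.log (2 ^ 8 * L) ≤ Real.log (256 * y) :=
      Real.log_le_log (by positivity) (by linarith)
    rw [Real.log_mul (by norm_num) (by linarith), Real.log_pow] at h3
    rw [Real.log_pow] at h1
    push_cast at h3
    have h4 := Real.log_two_gt_d9
    have h5 := Real.log_two_lt_d9
    nlinarith
  have swap : ∀ (β : ℝ) (j : ℕ), ((2 : ℝ) ^ β) ^ j = ((2 : ℝ) ^ j) ^ β := fun β j => by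
    rw [← Real.rpow_natCast, ← Real.rpow_natCast, ← Real.rpow_mul two_pos.le,
      ← Real.rpow_mul two_pos.le, mul_comm]
  set x : ℝ := (2 : ℝ) ^ (-α) with hx
  have hx0 : 0 < x := by positivity
  have hzx : z = 2 * x := by
    rw [hz, hx, sub_eq_add_neg, Real.rpow_add two_pos, Real.rpow_one]
  have hwx : w = 2 * x ^ 2 := by
    rw [hw, hx, sub_eq_add_neg, Real.rpow_add two_pos, Real.rpow_one, ← Real.rpow_natCast,
      ← Real.rpow_mul two_pos.le]
    congr 2; push_cast; ring
  have hmain := norm_gcdSum_le_of_dyadic (d := d) (α := α) (ε := ε) (B := C₂ * T) hα.le hε0 hε1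
    (G := fun j => if j ≤ J₀ then 7 * x ^ j else 16 * (x ^ j) ^ 2 / ε)
    (fun j => by split_ifs <;> positivity) (fun j hj => ?_) (fun J => ?_) f
  · refine hmain.trans ?_
    refine mul_le_mul_of_nonneg_right ?_ (sq_nonneg _)
    rw [card_rpow_eq_exp (by omega), ← Real.exp_add, one_mul, Real.exp_le_exp, mul_assoc, ← hT]
    linarith
  · rw [← hx]
    by_cases h : j ≤ J₀
    · left; rw [if_pos h]
    · right; left
      refine ⟨?_, by rw [if_neg h]⟩
      have h1 : (2 : ℝ) ^ J₀ ≤ 2 ^ j := pow_le_pow_right₀ one_le_two (by omega)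
      rw [hx, swap]
      have h2 : ((2 : ℝ) ^ j) ^ (-α) ≤ (256 * y) ^ (-α) :=
        Real.rpow_le_rpow_of_nonpos (by positivity) (by linarith) (by linarith)
      refine h2.trans ?_
      rw [Real.mul_rpow (by norm_num) hy0.le, ← hε]
      have h3 : (256 : ℝ) ^ (-α) ≤ 256 ^ (-(1 / 2) : ℝ) :=
        Real.rpow_le_rpow_of_exponent_le (by norm_num) (by linarith)
      have h4 : (256 : ℝ) ^ (-(1 / 2) : ℝ) = 1 / 16 := by
        rw [show (256 : ℝ) = 16 ^ (2 : ℝ) by norm_num, ← Real.rpow_mul (by norm_num)]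
        norm_num [Real.rpow_neg_one]
      rw [h4] at h3
      nlinarith
  · have h1 : ∀ j ∈ Icc 1 J, 4 * 2 ^ j / (j : ℝ) *
        (if j ≤ J₀ then 7 * x ^ j else 16 * (x ^ j) ^ 2 / ε)
        ≤ if j ≤ J₀ then 28 * (z ^ j / (j : ℝ)) else 64 / ((l + 2) * ε) * w ^ j := by
      intro j hj
      have hj1 : (1 : ℝ) ≤ j := by exact_mod_cast (mem_Icc.1 hj).1
      split_ifs with h
      · refine le_of_eq ?_
        rw [hzx, mul_pow]; ring
      · have hjl : l + 2 ≤ (j : ℝ) := by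
          have : (J₀ : ℝ) ≤ j := by exact_mod_cast (by omega : J₀ ≤ j)
          linarith
        calc _ = 64 / (j * ε) * w ^ j := by
              rw [hwx, mul_pow, ← pow_mul, ← pow_mul, mul_comm 2 j]
              field_simp; norm_num
          _ ≤ _ := by gcongr
    refine (sum_le_sum h1).trans ((sum_Icc_ite_le (fun j => by positivity)
      (fun j => by positivity) J₀ J).trans ?_)
    rw [hC₂, add_mul _ _ T]
    refine add_le_add ?_ ?_
    · rw [← mul_sum, mul_assoc]
      refine mul_le_mul_of_nonneg_left ((hsum J₀ hJ1).trans ?_) (by norm_num)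
      rw [mul_assoc]
      refine mul_le_mul_of_nonneg_left ?_ hC₁.le
      have h2 : z ^ J₀ ≤ 512 * y ^ (1 - α) := by
        rw [hz, swap]
        calc ((2 : ℝ) ^ J₀) ^ (1 - α) ≤ (512 * y) ^ (1 - α) :=
              Real.rpow_le_rpow (by positivity) (by linarith) (by linarith)
          _ = 512 ^ (1 - α) * y ^ (1 - α) := Real.mul_rpow (by norm_num) hy0.le
          _ ≤ 512 * y ^ (1 - α) := by
              refine mul_le_mul_of_nonneg_right ?_ (by positivity)
              calc (512 : ℝ) ^ (1 - α) ≤ 512 ^ (1 : ℝ) :=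
                    Real.rpow_le_rpow_of_exponent_le (by norm_num) (by linarith)
                _ = 512 := Real.rpow_one _
      calc z ^ J₀ / J₀ ≤ 512 * y ^ (1 - α) / (l + 2) := by gcongr
        _ = 512 * (y ^ (1 - α) / (l + 2)) := by ring
        _ ≤ _ := by gcongr
    · rw [← mul_sum]
      have h2 : w ^ J₀ ≤ y ^ (1 - 2 * α) := by
        rw [hw, swap]
        exact Real.rpow_le_rpow_of_nonpos hy0 (by linarith) (by linarith)
      have h3 : y ^ (1 - 2 * α) = y ^ (1 - α) * ε := by
        rw [hε, ← Real.rpow_add hy0]; congr 1; ring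
      calc _ ≤ 64 / ((l + 2) * ε) * (y ^ (1 - 2 * α) * (w / (1 - w))) := by
            refine mul_le_mul_of_nonneg_left ((sum_Ioc_pow_le hw0.le hw1 J₀ J).trans ?_)
              (by positivity)
            exact mul_le_mul_of_nonneg_right h2 hww.le
        _ = 64 * (w / (1 - w)) * (y ^ (1 - α) / (l + 2)) := by
            rw [h3]
            have : l + 2 ≠ 0 := by linarith
            have : 1 - w ≠ 0 := by linarith
            field_simp
        _ ≤ _ := by gcongr

/-- A bound in the case `α = 1/2` that is uniform in `f`. -/
theorem gcdSum_half_bound (d : ℕ) :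
    ∃ C : ℝ, 0 < C ∧ ∀ f : (Fin d → ℕ+) →₀ ℂ, 2 ≤ f.support.card →
      ‖gcdSum d (1 / 2) f‖ ≤
        Real.exp (C * √(Real.log (f.support.card : ℝ))) * l2Norm f ^ 2 := by
  obtain ⟨C₁, hC₁, hsum⟩ := exists_sum_pow_div_le (z := √2)
    (by rw [Real.lt_sqrt zero_le_one]; norm_num)
  set C₂ : ℝ := 28 * (C₁ * 23) + 64 + 256 with hC₂
  refine ⟨d * (C₂ * 2) + 1, by positivity, fun f hK => ?_⟩
  have hKR : (2 : ℝ) ≤ f.support.card := by exact_mod_cast hK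
  set L := Real.log (f.support.card : ℝ) with hLdef
  have hL : 1 / 2 ≤ L := by
    have h1 := Real.log_le_log two_pos hKR
    have h2 := Real.log_two_gt_d9
    linarith
  -- Adding 1 ensures `ε = 1 / R ≤ 1` even when `L < 1`.
  set R : ℝ := √(1 + L) with hR
  have hR2 : R ^ 2 = 1 + L := Real.sq_sqrt (by linarith)
  have hR1 : 1 ≤ R := by rw [hR]; exact Real.one_le_sqrt.2 (by linarith)
  have hR0 : 0 < R := by linarith
  set S : ℝ := √L with hS
  have hS0 : 0 ≤ S := Real.sqrt_nonneg _
  have hS2 : S ^ 2 = L := Real.sq_sqrt (by linarith)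
  have hSR : S ≤ R := Real.sqrt_le_sqrt (by linarith)
  have hRS : R ≤ 2 * S := by
    refine le_of_sq_le_sq ?_ (by positivity)
    rw [mul_pow, hS2, hR2]; linarith
  obtain ⟨J₀, hJ1, hJlt, hJle⟩ := exists_two_pow_near (by nlinarith : 1 ≤ 256 * R ^ 2)
  have hJ0R : (0 : ℝ) < J₀ := by exact_mod_cast hJ1
  set x : ℝ := (2 : ℝ) ^ (-(1 / 2) : ℝ) with hx
  have hx0 : 0 < x := by positivity
  have hx2 : x ^ 2 = 1 / 2 := by
    rw [hx, ← Real.rpow_natCast, ← Real.rpow_mul two_pos.le]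
    norm_num [Real.rpow_neg_one]
  have hxj : ∀ j : ℕ, (x ^ j) ^ 2 = 1 / 2 ^ j := fun j => by
    rw [← pow_mul, mul_comm, pow_mul, hx2, one_div_pow]
  have hxz : √2 = 2 * x := by
    rw [Real.sqrt_eq_iff_mul_self_eq zero_le_two (by positivity)]
    nlinarith
  have hlogx : ∀ j : ℕ, Real.log (1 / x ^ j) = j * (Real.log 2 / 2) := fun j => by
    rw [one_div, Real.log_inv, Real.log_pow, hx, Real.log_rpow two_pos]; ring
  -- At `α = 1/2` the bound `ρ² / ε` contributes `R / j` per block, which is summable only over a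
  -- bounded ratio such as `(J₀, 2 J₀]`. Beyond `2 J₀` one has `ρ ≤ ε² / 64`, and the logarithmic
  -- saving gives `R / j ^ 2`.
  have hmain := norm_gcdSum_le_of_dyadic (d := d) (α := 1 / 2) (ε := 1 / R) (B := C₂ * R) le_rfl
    (by positivity) (by rw [div_le_one hR0]; exact hR1)
    (G := fun j => if j ≤ J₀ then 7 * x ^ j else if j ≤ 2 * J₀ then 16 * (x ^ j) ^ 2 / (1 / R)
      else 8 * (x ^ j) ^ 2 / (1 / R * Real.log (1 / x ^ j)))
    (fun j => by
      rw [hlogx]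
      have := Real.log_two_gt_d9
      split_ifs <;> positivity) (fun j hj => ?_) (fun J => ?_) f
  · refine hmain.trans ?_
    refine mul_le_mul_of_nonneg_right ?_ (sq_nonneg _)
    rw [card_rpow_eq_exp (by omega), ← Real.exp_add, Real.exp_le_exp]
    have h1 : L * (1 / R) ≤ S := by
      rw [mul_one_div, div_le_iff₀ hR0, ← hS2]; nlinarith
    have h2 : d * (C₂ * R) ≤ d * (C₂ * (2 * S)) := by gcongr
    linarith
  · rw [← hx]
    by_cases h : j ≤ J₀
    · left; rw [if_pos h]
    right
    by_cases h' : j ≤ 2 * J₀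
    · left
      refine ⟨?_, by rw [if_neg h, if_pos h']⟩
      have h1 : (2 : ℝ) ^ J₀ ≤ 2 ^ j := pow_le_pow_right₀ one_le_two (by omega)
      refine le_of_sq_le_sq ?_ (by positivity)
      rw [hxj, div_pow, div_pow, one_pow, div_div,
        one_div_le_one_div (by positivity) (by positivity)]
      linarith
    · right
      refine ⟨?_, by rw [if_neg h, if_neg h']⟩
      have h1 : (2 : ℝ) ^ (2 * J₀) ≤ 2 ^ j := pow_le_pow_right₀ one_le_two (by omega)
      rw [mul_comm, pow_mul] at h1
      have h2 : (256 * R ^ 2) ^ 2 ≤ ((2 : ℝ) ^ J₀) ^ 2 :=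
        pow_le_pow_left₀ (by positivity) hJlt.le 2
      refine le_of_sq_le_sq ?_ (by positivity)
      rw [hxj, div_pow, div_pow, div_pow, one_pow, one_pow, div_div,
        one_div_le_one_div (by positivity) (by positivity)]
      nlinarith [sq_nonneg (R ^ 2)]
  · have h1 : ∀ j ∈ Icc 1 J, 4 * 2 ^ j / (j : ℝ) *
        (if j ≤ J₀ then 7 * x ^ j else if j ≤ 2 * J₀ then 16 * (x ^ j) ^ 2 / (1 / R)
          else 8 * (x ^ j) ^ 2 / (1 / R * Real.log (1 / x ^ j)))
        ≤ if j ≤ J₀ then 28 * (√2 ^ j / (j : ℝ)) else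
          (if j ≤ 2 * J₀ then 64 * R / J₀ else 0) + 128 * R * ((j : ℝ) ^ 2)⁻¹ := by
      intro j hj
      have hj1 : (1 : ℝ) ≤ j := by exact_mod_cast (mem_Icc.1 hj).1
      split_ifs with h h'
      · refine le_of_eq ?_
        rw [hxz, mul_pow]; ring
      · have hjl : (J₀ : ℝ) ≤ j := by exact_mod_cast (by omega : J₀ ≤ j)
        have h2 : 4 * 2 ^ j / (j : ℝ) * (16 * (x ^ j) ^ 2 / (1 / R)) = 64 * R / j := by
          rw [hxj]; field_simp; norm_num
        rw [h2]
        have h3 : 64 * R / j ≤ 64 * R / J₀ := by gcongr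
        have h4 : 0 ≤ 128 * R * ((j : ℝ) ^ 2)⁻¹ := by positivity
        linarith
      · have hlog := Real.log_two_gt_d9
        rw [hlogx, hxj, zero_add]
        calc _ = 64 * R * ((j : ℝ) ^ 2)⁻¹ * (1 / Real.log 2) := by
              field_simp; norm_num
          _ ≤ 64 * R * ((j : ℝ) ^ 2)⁻¹ * 2 := by
              gcongr
              rw [div_le_iff₀ (by linarith)]; linarith
          _ = _ := by ring
    refine (sum_le_sum h1).trans ((sum_Icc_ite_le (fun j => by positivity)
      (fun j => by split_ifs <;> positivity) J₀ J).trans ?_)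
    rw [sum_add_distrib, ← add_assoc, hC₂, add_mul, add_mul]
    refine add_le_add (add_le_add ?_ ?_) ?_
    · rw [← mul_sum, mul_assoc]
      refine mul_le_mul_of_nonneg_left ((hsum J₀ hJ1).trans ?_) (by norm_num)
      rw [mul_assoc]
      refine mul_le_mul_of_nonneg_left ?_ hC₁.le
      -- Here `2 ^ J₀ ≤ 512 R ^ 2` and `23 ^ 2 = 529`.
      have h2 : √2 ^ J₀ ≤ 23 * R := by
        refine le_of_sq_le_sq ?_ (by positivity)
        rw [← pow_mul, mul_comm, pow_mul, Real.sq_sqrt zero_le_two]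
        nlinarith
      refine le_trans (div_le_self (by positivity) ?_) h2
      exact_mod_cast hJ1
    · rw [← sum_filter]
      refine (sum_le_sum_of_subset_of_nonneg (t := Ioc J₀ (2 * J₀)) ?_
        (fun j _ _ => by positivity)).trans (le_of_eq ?_)
      · intro j hj
        simp only [mem_filter, mem_Ioc] at hj ⊢
        omega
      · rw [sum_const, Nat.card_Ioc, nsmul_eq_mul, show 2 * J₀ - J₀ = J₀ by omega]
        field_simp
    · rw [← mul_sum]
      have h2 := sum_Ioo_inv_sq_le (α := ℝ) J₀ (J + 1)
      rw [show Ioo J₀ (J + 1) = Ioc J₀ J by ext; simp only [mem_Ioo, mem_Ioc]; omega] at h2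
      have h3 : 2 / ((J₀ : ℝ) + 1) ≤ 2 := div_le_self (by norm_num) (by linarith)
      calc _ ≤ 128 * R * 2 := by gcongr; linarith
        _ = _ := by ring

/-! ### Assembly and the deduction of (iii). -/

theorem mainTheorem5 (d : ℕ) (hd : 1 ≤ d) :
    -- the case `α = 1`
    (∃ A : ℝ, 0 < A ∧ ∃ M : ℝ, 0 < M ∧
      ∀ f : (Fin d → ℕ+) →₀ ℂ, 3 ≤ f.support.card →
        ‖gcdSum d 1 f‖ ≤
          M * Real.log (Real.log (f.support.card : ℝ)) ^ A * l2Norm f ^ 2) ∧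
    -- the case `1/2 < α < 1`
    (∀ α : ℝ, 1 / 2 < α → α < 1 →
      ∃ C : ℝ, 0 < C ∧ ∃ M : ℝ, 0 < M ∧
        ∀ f : (Fin d → ℕ+) →₀ ℂ, 3 ≤ f.support.card →
          ‖gcdSum d α f‖ ≤
            M * Real.exp (C * Real.log (f.support.card : ℝ) ^ (1 - α) *
              Real.log (Real.log (f.support.card : ℝ)) ^ (-α)) * l2Norm f ^ 2) ∧
    -- the case `α = 1/2`, for `f` real and positive on its support
    (∃ C : ℝ, 0 < C ∧ ∃ M : ℝ, 0 < M ∧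
      ∀ f : (Fin d → ℕ+) →₀ ℂ, (∀ a, (f a).im = 0 ∧ 0 ≤ (f a).re) →
        3 ≤ l1Norm f → Real.log (l1Norm f) ≤ (f.support.card : ℝ) →
          ‖gcdSum d (1 / 2) f‖ ≤
            M * (Real.exp (C * (Real.log (f.support.card : ℝ) *
              Real.log (Real.log (l1Norm f))) ^ (1 / 2 : ℝ)) /
                Real.log (l1Norm f) ^ d) * l2Norm f ^ 2) := by
  refine ⟨gcdSum_one_bound d hd, gcdSum_bound_of_lt_one d hd, ?_⟩
  obtain ⟨C₀, hC₀, hbound⟩ := gcdSum_half_bound d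
  have hu₀ := loglog_three_pos
  set u₀ := Real.log (Real.log 3)
  -- The summand `d` pays for `(log ‖f‖₁) ^ d = exp (d u)`, since `u ≤ L` gives `u ≤ √(L u)`; the
  -- other summand turns `√L` into `√(L u)` through `u ≥ u₀ > 0`.
  refine ⟨d + C₀ / √u₀, by positivity, 1, one_pos, fun f _ h1 hK => ?_⟩
  set Λ := Real.log (l1Norm f)
  have hΛ : 1 < Λ := one_le_log_of_three_le h1
  have hu : u₀ ≤ Real.log Λ := loglog_three_le h1
  have hK2 : 2 ≤ f.support.card := by
    have : (1 : ℝ) < f.support.card := hΛ.trans_le hK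
    exact_mod_cast this
  have huL : Real.log Λ ≤ Real.log (f.support.card : ℝ) := Real.log_le_log (by linarith) hK
  refine (hbound f hK2).trans (mul_le_mul_of_nonneg_right ?_ (sq_nonneg _))
  set L := Real.log (f.support.card : ℝ)
  set u := Real.log Λ with hudef
  have hΛd : Λ ^ d = Real.exp (d * u) := by
    rw [mul_comm, Real.exp_mul, hudef, Real.exp_log (by linarith), Real.rpow_natCast]
  rw [one_mul, hΛd, ← Real.exp_sub, Real.exp_le_exp, ← Real.sqrt_eq_rpow, add_mul]
  have h2 : u ≤ √(L * u) := Real.le_sqrt_of_sq_le (by nlinarith)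
  have h3 : C₀ * √L ≤ C₀ / √u₀ * √(L * u) := by
    rw [Real.sqrt_mul (by linarith), div_mul_eq_mul_div, le_div_iff₀ (by positivity), mul_assoc]
    gcongr
  have h4 := mul_le_mul_of_nonneg_left h2 (Nat.cast_nonneg (α := ℝ) d)
  linarith
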